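/- Let $c_1,c_2,\dots$ be indeterminates over $\mathbf Q$, let $F(t)=t+c_1\frac{t^2}{2}+c_2\frac{t^3}{3}+\cdots$, let $G=F^{-1}$ be its compositional inverse ($F(G(t))=G(F(t))=t$), and define the universal Bernoulli numbers $\hat B_n\in\mathbf Q[c_1,\dots,c_n]$ by $\frac{t}{G(t)}=\sum_{n\ge0}\hat B_n\frac{t^n}{n!}$. Write $\mathbf Z_2$ for the 2-adic integers, and $a!!=a(a-2)\cdots3\cdot1$ for odd $a>0$. For $f,g\in\mathbf Q[c_1,c_2,\dots]$, $f\equiv g \pmod{2^{N+1}\mathbf Z_2[c_1,\dots,c_n]}$ means $f-g\in 2^{N+1}\mathbf Z_2[c_1,\dots,c_n]$. Theorem. Let $N\ge 3$, $m\ge 2N+1$, $l=k\cdot 2^N$ with $k$ a positive odd integer, and $n=m+l$. Then, modulo $2^{N+1}\mathbf Z_2[c_1,\dots,c_n]$: (i) If $2\nmid m$, then $$\frac{\hat B_n}{n}\equiv c_1^l\frac{\hat B_m}{m}+l\left(c_1^{n-12}c_3^4+c_1^{n-15}c_3^5+c_1^{n-5}c_2c_3+c_1^{n-8}c_2c_3^2+c_1^{n-7}c_7\right)+(-1)^{\frac{m+1}{2}}\frac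 l2\left(-c_1^n+c_1^{n-3}c_3+c_1^{n-6}c_3^2+c_1^{n-9}c_3^3\right).$$ (ii) If $2\mid m$ and $4\nmid m$, then $$\frac{\hat B_n}{n}\equiv c_1^l\frac{\hat B_m}{m}+\left(l+\frac{l}{2mn}\right)c_1^n+l\left(c_1^{n-9}c_3^3+c_1^{n-18}c_3^6+c_1^{n-5}c_2c_3+c_1^{n-8}c_2c_3^2\right)-\frac l2c_1^{n-3}c_3+\frac34l\,c_1^{n-6}c_3^2+\theta\, c_1^{n-12}c_3^4,$$ where $\theta=-\frac l2$ if $N=3$ and $\theta=\frac l2$ if $N\ge4$. (iii) If $4\mid m$ and $8\nmid m$, then $$\frac{\hat B_n}{n}\equiv c_1^l\frac{\hat B_m}{m}+\left(l-\frac{l}{2mn}\right)c_1^n+\frac l2c_1^{n-3}c_3+\frac l4\left(c_1^{n-6}c_3^2+c_1^{n-12}c_3^4\right)+l\left(c_1^{n-8}c_2c_3^2+c_1^{n-5}c_2c_3\right).$$ (iv) If $8\mid m$, then $$\frac{\hat B_n}{n}\equiv c_1^l\frac{\hat B_m}{m}-\left(\frac{(2n-3)!!}{2n}-\frac{(2m-3)!!}{2m}\right)c_1^n+\frac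 l2c_1^{n-3}c_3+\frac{5l}{4}c_1^{n-12}c_3^4+\frac l4c_1^{n-6}c_3^2+l\left(\epsilon\, c_1^{n-24}c_3^8+c_1^{n-5}c_2c_3+c_1^{n-8}c_2c_3^2\right),$$ where the term $\epsilon\,c_1^{n-24}c_3^8$ is $c_1^{n-24}c_3^8$ if $m\ge16$, and is absent if $m=8$ (which can occur only for $N=3$). -/

import Mathlib

open scoped Nat

namespace UniversalBernoulli

/-- `ℚ[c₁, c₂, …]`: the variables are indexed by the positive integers. -/
abbrev RatPoly : Type := MvPolynomial ℕ+ ℚ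

/-- The indeterminate `cᵢ`. -/
noncomputable def c (i : ℕ+) : RatPoly := MvPolynomial.X i

/-- `F(t) = t + c₁ t² / 2 + c₂ t³ / 3 + ⋯`. -/
noncomputable def F : PowerSeries RatPoly :=
  PowerSeries.mk fun j => match j with
    | 0 => 0
    | 1 => 1
    | i + 2 => ((i : ℚ) + 2)⁻¹ • c i.succPNat

theorem constantCoeff_F : PowerSeries.constantCoeff F = 0 := by
  rw [← PowerSeries.coeff_zero_eq_constantCoeff_apply, F, PowerSeries.coeff_mk]

theorem coeff_one_F : PowerSeries.coeff 1 F = 1 := by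
  rw [F, PowerSeries.coeff_mk]

theorem isUnit_coeff_one_F : IsUnit (PowerSeries.coeff 1 F) := by
  rw [coeff_one_F]; exact isUnit_one

/-- `G = F⁻¹`, the compositional inverse of `F`. -/
noncomputable def G : PowerSeries RatPoly :=
  PowerSeries.substInvOfIsUnit F isUnit_coeff_one_F

/-- `F(G(t)) = t`. -/
theorem F_subst_G : F.subst G = PowerSeries.X :=
  PowerSeries.subst_substInvOfIsUnit_right F constantCoeff_F isUnit_coeff_one_F

/-- `G(F(t)) = t`. -/
theorem G_subst_F : G.subst F = PowerSeries.X :=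
  PowerSeries.subst_substInvOfIsUnit_left F constantCoeff_F isUnit_coeff_one_F

/-- `t / G(t)`: the multiplicative inverse of `G(t) / t`, a series with constant term `1`. -/
noncomputable def bernoulliSeries : PowerSeries RatPoly :=
  PowerSeries.invOfUnit (PowerSeries.mk fun j => PowerSeries.coeff (j + 1) G) 1

theorem constantCoeff_G : PowerSeries.constantCoeff G = 0 := by
  simp [G]

theorem coeff_one_G : PowerSeries.coeff 1 G = 1 := by
  have hu : isUnit_coeff_one_F.unit = 1 := Units.ext coeff_one_F
  rw [G, PowerSeries.coeff_one_substInvOfIsUnit, hu, inv_one, Units.val_one]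

/-- `(t / G(t)) * G(t) = t`. -/
theorem bernoulliSeries_mul_G : bernoulliSeries * G = PowerSeries.X := by
  have h1 : G = (PowerSeries.mk fun j => PowerSeries.coeff (j + 1) G) * PowerSeries.X := by
    have := PowerSeries.eq_shift_mul_X_add_const G
    rwa [constantCoeff_G, map_zero, add_zero] at this
  have h2 : (PowerSeries.mk fun j => PowerSeries.coeff (j + 1) G) * bernoulliSeries = 1 := by
    apply PowerSeries.mul_invOfUnit
    rw [← PowerSeries.coeff_zero_eq_constantCoeff_apply, PowerSeries.coeff_mk, zero_add,
      coeff_one_G, Units.val_one]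
  rw [h1, ← mul_assoc, mul_comm bernoulliSeries, h2, one_mul]

/-- The universal Bernoulli number `B̂ₙ`: `t / G(t) = ∑ B̂ₙ tⁿ / n!`. -/
noncomputable def universalBernoulli (n : ℕ) : RatPoly :=
  (n ! : ℚ) • PowerSeries.coeff n bernoulliSeries

/-- The divided universal Bernoulli number `B̂ₙ / n` (used for `n ≥ 1`). -/
noncomputable def dividedBernoulli (n : ℕ) : RatPoly :=
  (n : ℚ)⁻¹ • universalBernoulli n

/-- `f ≡ g (mod 2^M ℤ₂[c₁, …, cₙ])`: the difference, taken in `ℚ₂[c₁, c₂, …]`, is `2^M` times a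
polynomial in `c₁, …, cₙ` with coefficients in the ring `ℤ₂` of 2-adic integers. -/
def CongrModTwoPow (n M : ℕ) (f g : RatPoly) : Prop :=
  ∃ h ∈ MvPolynomial.supported ℤ_[2] {i : ℕ+ | (i : ℕ) ≤ n},
    MvPolynomial.map (algebraMap ℚ ℚ_[2]) (f - g) =
      2 ^ M * MvPolynomial.map (algebraMap ℤ_[2] ℚ_[2]) h

end UniversalBernoulli

open UniversalBernoulli

/-! Lagrange inversion gives Clarke's closed form: for `v` free of `c₁` and `S = excess v`, the
monomial `c₁^(n - wt v) c^v` has in `B̂ₙ/n` the coefficient `tau v n = ± (2n-2-S)! / (2^(n - wt v)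
(n - wt v)! γ(v))`. The theorem thus asks, for each fixed `v`, how `tau v n` changes from `m` to `m
+ l`.

Separating odd and even factors of the factorial (`tau_eq`) turns `tau v n` into `±` an odd double
factorial times `lead v * C(n-1-⌈S/2⌉, J)`, where `J = ⌊(size v - 2)/2⌋` and `lead v = 2^J J!/γ(v)`.
The odd factor is unchanged modulo `2^(N+1)`, a product of `l` consecutive odd numbers being `1`
there. By Vandermonde the binomial changes by terms `C(l,i) C(·,J-i)` with `1 ≤ i ≤ J`, and `v₂
C(l,i) ≥ N - v₂(i)`; so nothing is left once `v₂(lead v) > log₂ J`. Legendre's formula makes this a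
digit-sum inequality, proved for all but eleven `v`. If `v` is too large for `tau_eq` at `m`, the
bound `m ≥ 2N+1` makes both coefficients divisible by `2^(N+1)` (for `c₃^8` this needs a separate
argument).

For `c₃^5, c₃^6, c₃^8, c₂c₃, c₂c₃², c₇` one has `v₂(lead v) = ⌊log₂ J⌋`: only `C(l, 2^λ)` with `λ =
⌊log₂ J⌋` survives, giving `l` times the parity of a binomial. For `c₃, …, c₃^4` and for `c₁^n`
denominators cost further bits, so `exists_oddProd_mul_two_pow` expands the odd product to precision
`2^(N+4)`, and tables in residues modulo 32 finish. When `8 ∣ m` the coefficient of `c₁^n` is kept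
exactly. -/

namespace UniversalBernoulli

/-! ### Lagrange inversion for `t / G(t)` -/

section Lagrange

open PowerSeries

/-- `F(t) / t`. -/
noncomputable def phi : PowerSeries RatPoly := PowerSeries.mk fun j => PowerSeries.coeff (j + 1) F

/-- `t / F(t)`. -/
noncomputable def psi : PowerSeries RatPoly := PowerSeries.invOfUnit phi 1

theorem constantCoeff_phi : PowerSeries.constantCoeff phi = 1 := by
  rw [← PowerSeries.coeff_zero_eq_constantCoeff_apply, phi, PowerSeries.coeff_mk, zero_add,
    coeff_one_F]

theorem F_eq_X_mul_phi : F = X * phi := by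
  have := PowerSeries.eq_X_mul_shift_add_const F
  rwa [constantCoeff_F, map_zero, add_zero] at this

theorem phi_mul_psi : phi * psi = 1 :=
  PowerSeries.mul_invOfUnit _ _ (by rw [constantCoeff_phi, Units.val_one])

theorem constantCoeff_psi : PowerSeries.constantCoeff psi = 1 := by
  have := congrArg PowerSeries.constantCoeff phi_mul_psi
  simpa [constantCoeff_phi] using this

theorem hasSubst_F : HasSubst F := HasSubst.of_constantCoeff_zero' constantCoeff_F

theorem bernoulliSeries_subst_F : bernoulliSeries.subst F = phi := by
  have h := congrArg (PowerSeries.subst F) bernoulliSeries_mul_G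
  rw [PowerSeries.subst_mul hasSubst_F, G_subst_F, PowerSeries.subst_X hasSubst_F,
    F_eq_X_mul_phi, mul_comm] at h
  rw [F_eq_X_mul_phi]
  exact mul_left_cancel₀ PowerSeries.X_ne_zero h

local notation "∂" => PowerSeries.derivative RatPoly

theorem derivative_F : ∂ F = phi + X * ∂ phi := by
  conv_lhs => rw [F_eq_X_mul_phi]
  rw [Derivation.leibniz, PowerSeries.derivative_X]
  simp [add_comm]

theorem derivative_psi_pow (j : ℕ) : ∂ (psi ^ j) = -((j : PowerSeries RatPoly) * psi ^ (j + 1) * ∂ phi) := by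
  have h : ∂ psi = -(psi ^ 2 * ∂ phi) := by
    have := congrArg ∂ phi_mul_psi
    rw [Derivation.leibniz, Derivation.map_one_eq_zero] at this
    have h2 := congrArg (psi * ·) this
    simp only [smul_eq_mul, mul_add, mul_zero] at h2
    rw [← mul_assoc, mul_comm psi phi, phi_mul_psi, one_mul] at h2
    linear_combination h2
  cases j with
  | zero => simp
  | succ j =>
    rw [Derivation.leibniz_pow, h]
    simp only [nsmul_eq_mul, smul_eq_mul, Nat.add_sub_cancel]
    ring

/-- This is the residue of `F'/F^(j+1)`: for `j > 0` that form is the derivative of `-F^(-j)/j`, so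
its residue vanishes. -/
theorem coeff_psi_pow_mul_derivative_F (j : ℕ) :
    PowerSeries.coeff j (psi ^ (j + 1) * ∂ F) = if j = 0 then 1 else 0 := by
  rcases j with _ | j
  · simp [derivative_F, constantCoeff_phi, constantCoeff_psi]
  · rw [if_neg (by omega)]
    have h0 : (((j + 1 : ℕ) : RatPoly)) ≠ 0 := by exact_mod_cast Nat.succ_ne_zero j
    apply mul_left_cancel₀ h0
    have h1 : ((j + 1 : ℕ) : PowerSeries RatPoly) * (psi ^ (j + 1 + 1) * ∂ F)
        = ((j + 1 : ℕ) : PowerSeries RatPoly) * psi ^ (j + 1) - X * ∂ (psi ^ (j + 1)) := by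
      rw [derivative_F, derivative_psi_pow]
      linear_combination (((j + 1 : ℕ) : PowerSeries RatPoly) * psi ^ (j + 1)) * phi_mul_psi
    have h2 := congrArg (PowerSeries.coeff (j + 1)) h1
    have h3 : ∀ f : PowerSeries RatPoly, PowerSeries.coeff (j + 1) (((j + 1 : ℕ) : PowerSeries RatPoly) * f)
        = ((j + 1 : ℕ) : RatPoly) * PowerSeries.coeff (j + 1) f := by
      intro f
      rw [← nsmul_eq_mul, ← nsmul_eq_mul, map_nsmul]
    rw [map_sub, h3, h3, PowerSeries.coeff_succ_X_mul, PowerSeries.coeff_derivative] at h2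
    rw [h2]; push_cast; ring

/-- Residue form of coefficient extraction, `[tⁿ] f = Res f(F) F'/F^(n+1)`. Peeling off the constant
term of `f` leaves a multiple of `F`, and `psi * F = X` lowers `n` by one. -/
theorem coeff_psi_pow_mul_subst (n : ℕ) : ∀ f : PowerSeries RatPoly,
    PowerSeries.coeff n (psi ^ (n + 1) * f.subst F * ∂ F) = PowerSeries.coeff n f := by
  induction n with
  | zero =>
    intro f
    have h : f.subst F = F * (PowerSeries.mk fun p => PowerSeries.coeff (p + 1) f).subst F
        + PowerSeries.C (PowerSeries.constantCoeff f) := by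
      conv_lhs => rw [PowerSeries.eq_X_mul_shift_add_const f]
      rw [PowerSeries.subst_add hasSubst_F, PowerSeries.subst_mul hasSubst_F,
        PowerSeries.subst_X hasSubst_F, PowerSeries.subst_C]; rfl
    rw [h, derivative_F]
    simp [constantCoeff_phi, constantCoeff_psi, constantCoeff_F]
  | succ n ih =>
    intro f
    have h : f.subst F = F * (PowerSeries.mk fun p => PowerSeries.coeff (p + 1) f).subst F
        + PowerSeries.C (PowerSeries.constantCoeff f) := by
      conv_lhs => rw [PowerSeries.eq_X_mul_shift_add_const f]
      rw [PowerSeries.subst_add hasSubst_F, PowerSeries.subst_mul hasSubst_F,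
        PowerSeries.subst_X hasSubst_F, PowerSeries.subst_C]; rfl
    set g := PowerSeries.mk fun p => PowerSeries.coeff (p + 1) f
    have h1 : psi ^ (n + 1 + 1) * f.subst F * ∂ F
        = X * (psi ^ (n + 1) * g.subst F * ∂ F)
          + PowerSeries.C (PowerSeries.constantCoeff f) * (psi ^ (n + 1 + 1) * ∂ F) := by
      rw [h]
      nth_rewrite 1 [F_eq_X_mul_phi]
      linear_combination (psi ^ (n + 1) * X * g.subst F * ∂ F) * phi_mul_psi
    rw [h1, map_add, PowerSeries.coeff_succ_X_mul, ih, PowerSeries.coeff_C_mul,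
      coeff_psi_pow_mul_derivative_F, if_neg (by omega), mul_zero, add_zero, PowerSeries.coeff_mk]

/-- Lagrange inversion for `t / G(t)`. -/
theorem coeff_bernoulliSeries (n : ℕ) :
    ((n + 1 : ℕ) : RatPoly) * PowerSeries.coeff (n + 2) bernoulliSeries
      = -PowerSeries.coeff (n + 2) (psi ^ (n + 1)) := by
  -- Differentiating `B(F) = phi` expresses `(n+2) [t^(n+2)] B` through `psi^(n+2) * phi'`, which is
  -- the derivative of `psi^(n+1)` up to the factor `-(n+1)`.
  have h1 : ∂ phi = (∂ bernoulliSeries).subst F * ∂ F := by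
    rw [← PowerSeries.derivative_subst hasSubst_F, bernoulliSeries_subst_F]
  have h2 := coeff_psi_pow_mul_subst (n + 1) (∂ bernoulliSeries)
  rw [mul_assoc, ← h1, PowerSeries.coeff_derivative] at h2
  have h3 := congrArg (PowerSeries.coeff (n + 1)) (derivative_psi_pow (n + 1))
  rw [PowerSeries.coeff_derivative, mul_assoc, map_neg, ← nsmul_eq_mul, map_nsmul, h2,
    nsmul_eq_mul] at h3
  have h0 : (((n + 1 : ℕ) : RatPoly) + 1) ≠ 0 := by exact_mod_cast Nat.succ_ne_zero (n + 1)
  apply mul_right_cancel₀ h0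
  linear_combination h3

end Lagrange

/-! ### Clarke's formula: coefficients of powers of `t / F(t)` -/

/-- The weight `∑ i uᵢ` of an exponent vector. -/
noncomputable def wt : (ℕ+ →₀ ℕ) →+ ℕ := Finsupp.weight fun i : ℕ+ => (i : ℕ)

/-- `γ(u) = ∏ (i+1)^{uᵢ} uᵢ!`. -/
noncomputable def gam (u : ℕ+ →₀ ℕ) : ℕ := u.prod fun i k => ((i : ℕ) + 1) ^ k * k !

theorem wt_single (i : ℕ+) (k : ℕ) : wt (Finsupp.single i k) = k * i := by
  rw [wt, Finsupp.weight_single, smul_eq_mul]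

instance nonTorsionWeight_coe : Finsupp.NonTorsionWeight ℕ (fun i : ℕ+ => (i : ℕ)) :=
  Finsupp.nonTorsionWeight_of (R := ℕ) (w := fun i : ℕ+ => (i : ℕ)) fun i => PNat.ne_zero i

theorem wt_eq_zero {u : ℕ+ →₀ ℕ} : wt u = 0 ↔ u = 0 :=
  Finsupp.weight_eq_zero_iff_eq_zero (fun i : ℕ+ => (i : ℕ))

theorem le_wt {u : ℕ+ →₀ ℕ} {i : ℕ+} (h : u i ≠ 0) : (i : ℕ) ≤ wt u :=
  Finsupp.le_weight_of_ne_zero' (fun i : ℕ+ => (i : ℕ)) h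

theorem gam_zero : gam 0 = 1 := Finsupp.prod_zero_index

theorem gam_pos (u : ℕ+ →₀ ℕ) : 0 < gam u :=
  Finset.prod_pos fun _ _ => by positivity

theorem gam_erase (u : ℕ+ →₀ ℕ) (i : ℕ+) :
    gam u = ((i : ℕ) + 1) ^ (u i) * (u i)! * gam (u.erase i) := by
  exact (Finsupp.mul_prod_erase' u i (fun (i : ℕ+) k => ((i : ℕ) + 1) ^ k * k !)
    (fun _ => by simp)).symm

theorem sub_single_add {u : ℕ+ →₀ ℕ} {i : ℕ+} (h : u i ≠ 0) :
    u - Finsupp.single i 1 + Finsupp.single i 1 = u :=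
  tsub_add_cancel_of_le (Finsupp.single_le_iff.2 (Nat.one_le_iff_ne_zero.2 h))

theorem gam_sub_single {u : ℕ+ →₀ ℕ} {i : ℕ+} (h : u i ≠ 0) :
    gam u = gam (u - Finsupp.single i 1) * (((i : ℕ) + 1) * u i) := by
  rw [gam_erase u i, gam_erase (u - Finsupp.single i 1) i]
  have h1 : (u - Finsupp.single i 1).erase i = u.erase i := by
    ext j
    by_cases hj : j = i
    · subst hj; simp
    · simp [Finsupp.erase_ne hj, Finsupp.single_eq_of_ne hj]
  rw [h1]
  obtain ⟨k, hk⟩ := Nat.exists_eq_succ_of_ne_zero h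
  have h2 : (u - Finsupp.single i 1 : ℕ+ →₀ ℕ) i = k := by simp [hk]
  rw [h2, hk, Nat.factorial_succ, pow_succ, Nat.succ_eq_add_one]
  ring

/-- The coefficient of `c^u` in `(t / F(t))^r`. -/
noncomputable def psiCoeff (r : ℕ) (u : ℕ+ →₀ ℕ) : ℚ :=
  (-1) ^ u.degree * (r.ascFactorial u.degree : ℚ) / gam u

theorem psiCoeff_zero (u : ℕ+ →₀ ℕ) : psiCoeff 0 u = if u = 0 then 1 else 0 := by
  split_ifs with h
  · subst h; simp [psiCoeff, gam_zero]
  · obtain ⟨k, hk⟩ := Nat.exists_eq_succ_of_ne_zero (fun h0 => h ((Finsupp.degree_eq_zero_iff u).1 h0))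
    rw [psiCoeff, hk, Nat.zero_ascFactorial]; simp

/-- Coefficient form of `phi * psi^(r+1) = psi^r`. Removing one `cᵢ` divides `γ` by `(i+1) uᵢ`, so
the sum collapses through `∑ uᵢ = deg u`. -/
theorem psiCoeff_succ (r : ℕ) (u : ℕ+ →₀ ℕ) :
    psiCoeff (r + 1) u
      + ∑ i ∈ u.support, ((i : ℚ) + 1)⁻¹ * psiCoeff (r + 1) (u - Finsupp.single i 1)
      = psiCoeff r u := by
  rcases Nat.eq_zero_or_eq_succ_pred u.degree with h0 | h0
  · rw [Finsupp.degree_eq_zero_iff] at h0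
    subst h0; simp [psiCoeff]
  · set d := u.degree.pred
    have hg : (gam u : ℚ) ≠ 0 := by exact_mod_cast (gam_pos u).ne'
    have h1 : ∀ i ∈ u.support, ((i : ℚ) + 1)⁻¹ * psiCoeff (r + 1) (u - Finsupp.single i 1)
        = (-1) ^ d * ((r + 1).ascFactorial d : ℚ) / gam u * (u i : ℚ) := by
      intro i hi
      have hi' := Finsupp.mem_support_iff.1 hi
      have hd : (u - Finsupp.single i 1).degree = d := by
        have := congrArg Finsupp.degree (sub_single_add hi')
        rw [map_add, Finsupp.degree_single] at this
        omega
      rw [psiCoeff, hd, gam_sub_single hi']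
      have h2 : (gam (u - Finsupp.single i 1) : ℚ) ≠ 0 := by exact_mod_cast (gam_pos _).ne'
      have h3 : (u i : ℚ) ≠ 0 := by exact_mod_cast hi'
      have h4 : ((i : ℚ) + 1) ≠ 0 := by positivity
      push_cast
      field_simp
    have h5 : (r.ascFactorial d.succ : ℚ) = r * (r + 1).ascFactorial d := by
      rw [Nat.ascFactorial_succ, ← Nat.succ_ascFactorial, Nat.cast_mul]
    rw [Finset.sum_congr rfl h1, ← Finset.mul_sum, ← Nat.cast_sum, ← Finsupp.degree_apply, psiCoeff,
      psiCoeff, h0, h5, Nat.ascFactorial_succ, Nat.succ_eq_add_one, pow_succ]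
    field_simp
    push_cast
    ring

theorem coeff_phi_zero : PowerSeries.coeff 0 phi = 1 := by
  rw [phi, PowerSeries.coeff_mk, zero_add, coeff_one_F]

theorem coeff_phi_succ (i : ℕ) :
    PowerSeries.coeff (i + 1) phi = MvPolynomial.C (((i.succPNat : ℕ) : ℚ) + 1)⁻¹ * c i.succPNat := by
  rw [phi, PowerSeries.coeff_mk, F, PowerSeries.coeff_mk]
  change ((i : ℚ) + 2)⁻¹ • c i.succPNat = _
  rw [MvPolynomial.smul_eq_C_mul]
  simp only [Nat.succPNat_coe]
  congr 3
  push_cast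
  ring

/-- Since `phi` has constant term `1`, the identity `phi * psi^(r+1) = psi^r` determines each
coefficient of `psi^(r+1)` from lower ones; hence an inner strong induction on `n`. -/
theorem coeff_psi_pow (r : ℕ) : ∀ (n : ℕ) (u : ℕ+ →₀ ℕ),
    MvPolynomial.coeff u (PowerSeries.coeff n (psi ^ r)) = if wt u = n then psiCoeff r u else 0 := by
  induction r with
  | zero =>
    intro n u
    rw [pow_zero, PowerSeries.coeff_one, psiCoeff_zero]
    by_cases hn : n = 0
    · subst hn
      simp only [wt_eq_zero, if_true, MvPolynomial.coeff_one, eq_comm (a := u)]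
      split_ifs <;> rfl
    · rw [if_neg hn, MvPolynomial.coeff_zero]
      split_ifs with h1 h2
      · subst h2; exact absurd (h1.symm.trans (map_zero wt)) hn
      · rfl
      · rfl
  | succ r ih =>
    intro n
    induction n using Nat.strong_induction_on with
    | _ n ihn =>
    intro u
    have h := congrArg (fun f => MvPolynomial.coeff u (PowerSeries.coeff n f))
      (show phi * psi ^ (r + 1) = psi ^ r by
        rw [pow_succ', ← mul_assoc, phi_mul_psi, one_mul])
    beta_reduce at h
    rw [ih, PowerSeries.coeff_mul, Finset.Nat.sum_antidiagonal_eq_sum_range_succ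
      (fun i j => PowerSeries.coeff i phi * PowerSeries.coeff j (psi ^ (r + 1))),
      Finset.sum_range_succ', coeff_phi_zero, one_mul, Nat.sub_zero, MvPolynomial.coeff_add,
      MvPolynomial.coeff_sum] at h
    have h1 : ∀ i ∈ Finset.range n, MvPolynomial.coeff u
        (PowerSeries.coeff (i + 1) phi * PowerSeries.coeff (n - (i + 1)) (psi ^ (r + 1)))
        = if wt u = n then (if i.succPNat ∈ u.support then
          (((i.succPNat : ℕ) : ℚ) + 1)⁻¹ * psiCoeff (r + 1) (u - Finsupp.single i.succPNat 1) else 0)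
          else 0 := by
      intro i hi
      rw [Finset.mem_range] at hi
      rw [coeff_phi_succ, mul_assoc, MvPolynomial.coeff_C_mul, c, MvPolynomial.coeff_X_mul',
        ihn _ (by omega)]
      by_cases hs : i.succPNat ∈ u.support
      · have hw := congrArg wt (sub_single_add (Finsupp.mem_support_iff.1 hs))
        rw [map_add, wt_single, one_mul, Nat.succPNat_coe] at hw
        have : wt (u - Finsupp.single i.succPNat 1) = n - (i + 1) ↔ wt u = n := by omega
        simp only [hs, if_true, this, mul_ite, mul_zero]
      · simp only [hs, if_false, mul_zero, ite_self]
    rw [Finset.sum_congr rfl h1] at h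
    by_cases hw : wt u = n
    · simp only [hw, if_true] at h ⊢
      have h2 : ∑ i ∈ Finset.range n, (if i.succPNat ∈ u.support then
          (((i.succPNat : ℕ) : ℚ) + 1)⁻¹ * psiCoeff (r + 1) (u - Finsupp.single i.succPNat 1) else 0)
          = ∑ i ∈ u.support, ((i : ℚ) + 1)⁻¹ * psiCoeff (r + 1) (u - Finsupp.single i 1) := by
        rw [← Finset.sum_filter]
        refine Finset.sum_bij' (fun i _ => i.succPNat) (fun i _ => i.natPred) ?_ ?_ ?_ ?_ ?_
        · intro i hi; exact (Finset.mem_filter.1 hi).2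
        · intro i hi
          have := le_wt (Finsupp.mem_support_iff.1 hi)
          have h3 := PNat.natPred_add_one i
          simp only [Finset.mem_filter, Finset.mem_range, PNat.succPNat_natPred]
          exact ⟨by omega, hi⟩
        · intro i hi; simp
        · intro i hi; simp
        · intro i hi; rfl
      rw [h2] at h
      linear_combination h - psiCoeff_succ r u
    · simp only [hw, if_false, Finset.sum_const_zero, zero_add] at h ⊢
      exact h

/-- Clarke's formula for the coefficients of the divided universal Bernoulli numbers. -/
theorem coeff_dividedBernoulli (n : ℕ) (hn : 2 ≤ n) (u : ℕ+ →₀ ℕ) :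
    MvPolynomial.coeff u (dividedBernoulli n)
      = if wt u = n then (-1) ^ (u.degree + 1) * ((n - 2 + u.degree)! : ℚ) / gam u else 0 := by
  obtain ⟨n, rfl⟩ := Nat.exists_eq_add_of_le' hn
  have h := congrArg (MvPolynomial.coeff u) (coeff_bernoulliSeries n)
  rw [← nsmul_eq_mul, MvPolynomial.coeff_smul, MvPolynomial.coeff_neg, coeff_psi_pow,
    nsmul_eq_mul] at h
  rw [dividedBernoulli, universalBernoulli, MvPolynomial.coeff_smul, MvPolynomial.coeff_smul]
  have h1 : ((n + 2)! : ℚ) = (n + 2 : ℕ) * ((n + 1 : ℕ) * (n ! : ℚ)) := by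
    rw [Nat.factorial_succ, Nat.factorial_succ]; push_cast; ring
  have h2 : ((n + 2 : ℕ) : ℚ) ≠ 0 := by positivity
  simp only [smul_eq_mul]
  rw [h1, mul_assoc ((n + 2 : ℕ) : ℚ), inv_mul_cancel_left₀ h2, mul_comm ((n + 1 : ℕ) : ℚ), mul_assoc,
    h, Nat.add_sub_cancel]
  split_ifs
  · rw [psiCoeff, ← Nat.factorial_mul_ascFactorial]
    push_cast
    ring
  · simp

/-! ### Digit sums and the 2-adic valuation of `γ` -/

/-- The binary digit sum. -/
def digitSum (n : ℕ) : ℕ := (Nat.digits 2 n).sum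

theorem padicValNat_factorial_two (n : ℕ) : padicValNat 2 n ! = n - digitSum n := by
  have := sub_one_mul_padicValNat_factorial (p := 2) n
  simpa [digitSum] using this

theorem digitSum_le (n : ℕ) : digitSum n ≤ n := Nat.digit_sum_le 2 n

theorem digitSum_bit (b n : ℕ) (hb : b < 2) : digitSum (b + 2 * n) = b + digitSum n := by
  rcases Nat.eq_zero_or_pos (b + 2 * n) with h | h
  · have h1 : b = 0 := by omega
    have h2 : n = 0 := by omega
    subst h1; subst h2; rfl
  · rw [digitSum, Nat.digits_def' one_lt_two h, List.sum_cons, digitSum]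
    congr 1
    · omega
    · congr 2; omega

theorem digitSum_pos {n : ℕ} (h : n ≠ 0) : 0 < digitSum n := by
  induction n using Nat.strong_induction_on with
  | _ n ih =>
    have h1 := digitSum_bit (n % 2) (n / 2) (by omega)
    rw [show n % 2 + 2 * (n / 2) = n by omega] at h1
    by_cases h2 : n / 2 = 0
    · omega
    · have := ih (n / 2) (by omega) h2
      omega

theorem digitSum_le_log (n : ℕ) : digitSum n ≤ Nat.log2 n + 1 := by
  induction n using Nat.strong_induction_on with
  | _ n ih =>
    have h1 := digitSum_bit (n % 2) (n / 2) (by omega)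
    rw [show n % 2 + 2 * (n / 2) = n by omega] at h1
    by_cases h2 : n < 2
    · interval_cases n <;> decide
    · have := ih (n / 2) (by omega)
      rw [Nat.log2_def, if_pos (by omega)]
      omega

theorem log2_le_div (n : ℕ) : Nat.log2 n ≤ n / 32 + 4 := by
  induction n using Nat.strong_induction_on with
  | _ n ih =>
    by_cases h2 : n < 64
    · interval_cases n <;> decide
    · have := ih (n / 2) (by omega)
      rw [Nat.log2_def, if_pos (by omega)]
      omega

/-- Here `p = i + 1` is the factor that `cᵢ` brings into `γ`. At `p = 4` even the first bound fails,
which is why `c₃` is treated apart throughout; `p = 8`, that is `c₇`, fails only the second. -/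
theorem three_mul_padicValNat_le (p : ℕ) (h3 : 3 ≤ p) (h4 : p ≠ 4) :
    2 * (padicValNat 2 p + 1) ≤ p ∧ (p ≠ 8 → 3 * (padicValNat 2 p + 1) ≤ p) := by
  obtain ⟨a, ha⟩ := pow_padicValNat_dvd (p := 2) (n := p)
  set v := padicValNat 2 p
  have ha0 : a ≠ 0 := by rintro rfl; omega
  have key : ∀ k, 3 * (k + 4 + 1) ≤ 2 ^ (k + 4) := by
    intro k
    induction k with
    | zero => norm_num
    | succ k ih => rw [show k + 1 + 4 = k + 4 + 1 by ring, pow_succ]; omega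
  rcases lt_or_ge v 4 with h | h
  · interval_cases v <;> omega
  · have h5 := key (v - 4)
    rw [Nat.sub_add_cancel h] at h5
    have : 2 ^ v * 1 ≤ 2 ^ v * a := Nat.mul_le_mul_left _ (by omega)
    omega

/-- `∑ (i+1) uᵢ`. -/
noncomputable def size : (ℕ+ →₀ ℕ) →+ ℕ := Finsupp.weight fun i : ℕ+ => (i : ℕ) + 1

/-- `∑ (i-1) uᵢ`. -/
noncomputable def excess : (ℕ+ →₀ ℕ) →+ ℕ := Finsupp.weight fun i : ℕ+ => (i : ℕ) - 1

theorem size_single (i : ℕ+) (k : ℕ) : size (Finsupp.single i k) = k * (i + 1) := by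
  rw [size, Finsupp.weight_single, smul_eq_mul]

theorem excess_single (i : ℕ+) (k : ℕ) : excess (Finsupp.single i k) = k * (i - 1) := by
  rw [excess, Finsupp.weight_single, smul_eq_mul]

theorem size_eq (u : ℕ+ →₀ ℕ) : size u = wt u + u.degree := by
  induction u using Finsupp.induction_linear with
  | zero => simp
  | add f g hf hg => simp only [map_add, hf, hg]; omega
  | single i k => rw [size_single, wt_single, Finsupp.degree_single]; ring

theorem wt_eq (u : ℕ+ →₀ ℕ) : wt u = excess u + u.degree := by
  induction u using Finsupp.induction_linear with
  | zero => simp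
  | add f g hf hg => simp only [map_add, hf, hg]; omega
  | single i k =>
    rw [excess_single, wt_single, Finsupp.degree_single]
    have := i.pos
    obtain ⟨j, hj⟩ := Nat.exists_eq_succ_of_ne_zero this.ne'
    rw [hj, Nat.succ_sub_one, Nat.succ_eq_add_one]; ring

theorem gam_single_add (i : ℕ+) (k : ℕ) (f : ℕ+ →₀ ℕ) (h : f i = 0) :
    gam (Finsupp.single i k + f) = ((i : ℕ) + 1) ^ k * k ! * gam f := by
  rw [gam_erase _ i]
  congr 2
  · simp [h]
  · simp [h]
  · ext j
    by_cases hj : j = i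
    · subst hj; simp [h]
    · simp [Finsupp.erase_ne hj]

theorem gam_single (i : ℕ+) (k : ℕ) : gam (Finsupp.single i k) = ((i : ℕ) + 1) ^ k * k ! := by
  simpa [gam_zero] using gam_single_add i k 0 rfl

theorem padicValNat_gam_single_add (i : ℕ+) (k : ℕ) (f : ℕ+ →₀ ℕ) (h : f i = 0) :
    padicValNat 2 (gam (Finsupp.single i k + f))
      = k * padicValNat 2 (i + 1) + (k - digitSum k) + padicValNat 2 (gam f) := by
  rw [gam_single_add i k f h, padicValNat.mul (by positivity) (gam_pos f).ne',
    padicValNat.mul (by positivity) (by positivity), padicValNat.pow _ _,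
    padicValNat_factorial_two]

/-- A factor `cᵢ^k` contributes `k v₂(i+1) + k - s(k)` with `s(k) ≥ 1` the digit sum; this
positivity supplies the `+ 1` next to the valuation. -/
theorem padicValNat_gam_bound (r : ℕ+ →₀ ℕ) :
    r 1 = 0 → r 3 = 0 → r ≠ 0 →
      2 * (padicValNat 2 (gam r) + 1) ≤ size r ∧ excess r + 2 ≤ size r ∧ 3 ≤ size r ∧
      size r ≤ 3 * excess r ∧
      (r 7 = 0 → 3 * (padicValNat 2 (gam r) + 1) ≤ size r) := by
  induction r using Finsupp.induction with
  | zero => intro _ _ h; exact absurd rfl h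
  | single_add i k f hi hk ih =>
    intro h1 h3 _
    have hfi : f i = 0 := Finsupp.notMem_support_iff.1 hi
    have hi1 : i ≠ 1 := by rintro rfl; simp at h1; omega
    have hi3 : i ≠ 3 := by rintro rfl; simp at h3; omega
    have hi1' : (i : ℕ) ≠ 1 := fun h => hi1 (PNat.coe_injective h)
    have hi3' : (i : ℕ) ≠ 3 := fun h => hi3 (PNat.coe_injective h)
    have hi0 := i.pos
    have hf1 : f 1 = 0 := by rw [Finsupp.add_apply] at h1; omega
    have hf3 : f 3 = 0 := by rw [Finsupp.add_apply] at h3; omega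
    have hp := three_mul_padicValNat_le (i + 1) (by omega) (by omega)
    rw [padicValNat_gam_single_add i k f hfi, map_add, map_add, size_single, excess_single]
    have hd := digitSum_pos hk
    have hk1 : 1 ≤ k := by omega
    have e1 := Nat.mul_le_mul_left k hp.1
    have e2 : k * 1 ≤ k * (i - 1) := Nat.mul_le_mul_left k (by omega)
    have e3 : k * ((i : ℕ) + 1) = k * (i - 1) + k * 2 := by rw [← mul_add]; congr 1; omega
    have e4 : (i : ℕ) = 7 ∨ k * (3 * (padicValNat 2 (i + 1) + 1)) ≤ k * (i + 1) := by
      by_cases h7 : (i : ℕ) = 7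
      · exact Or.inl h7
      · exact Or.inr (Nat.mul_le_mul_left k (hp.2 (by omega)))
    have e5 : (Finsupp.single i k + f) 7 = 0 → (i : ℕ) ≠ 7 ∧ f 7 = 0 := by
      intro h
      rw [Finsupp.add_apply] at h
      refine ⟨fun hi7 => ?_, by omega⟩
      have : i = 7 := PNat.coe_injective hi7
      subst this; simp at h; omega
    have e6 : k * (2 * (padicValNat 2 (i + 1) + 1)) = 2 * (k * padicValNat 2 (i + 1)) + 2 * k := by ring
    have e7 : k * (3 * (padicValNat 2 (i + 1) + 1)) = 3 * (k * padicValNat 2 (i + 1)) + 3 * k := by ring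
    by_cases hf : f = 0
    · subst hf
      simp only [gam_zero, padicValNat_one_right, map_zero]
      refine ⟨by omega, by omega, by omega, by omega, fun h => ?_⟩
      have := e5 h
      omega
    · obtain ⟨a1, a2, a3, a4, a5⟩ := ih hf1 hf3 hf
      refine ⟨by omega, by omega, by omega, by omega, fun h => ?_⟩
      have := e5 h
      have := a5 this.2
      omega

/-- Finite part of `log2_add_le`: `M` is `size v - 2`, `b` the exponent of `c₃`, `M + 2 - 4 * b` the
size of the rest. The range of `b` is all that `4 * b ≤ M + 2` allows. -/
theorem numeric_bound_pure : ∀ M < 64, ∀ b < 17, (4 * b = M + 2 ∧ (b = 7 ∨ 9 ≤ b)) →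
    Nat.log2 M + 2 + digitSum M ≤ b + digitSum b := by
  decide +kernel

theorem numeric_bound_third : ∀ M < 64, ∀ b < 17, 4 * b + 3 ≤ M + 2 →
    (M + 2 - 4 * b = 3 → b = 0 ∨ 3 ≤ b) →
      Nat.log2 M + digitSum M + (M + 2 - 4 * b) / 3 + 1 ≤ b + digitSum b + (M + 2 - 4 * b) := by
  decide +kernel

theorem numeric_bound_half : ∀ M < 64, ∀ b < 17, 4 * b + 8 ≤ M + 2 →
    (b = 0 → 10 ≤ M + 2) →
      Nat.log2 M + digitSum M + (M + 2 - 4 * b) / 2 + 1 ≤ b + digitSum b + (M + 2 - 4 * b) := by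
  decide +kernel

/-- `Y` and `X` are the size and the `γ`-valuation of the part of `v` without `c₃`. The cases are a
pure power of `c₃`, a rest without `c₇`, and a rest with `c₇`. For `M ≥ 64` linear bounds on
logarithm and digit sum suffice. -/
theorem log2_add_le {b X Y : ℕ}
    (h : (Y = 0 ∧ X = 0 ∧ 7 ≤ b ∧ b ≠ 8) ∨ (3 ≤ Y ∧ ¬ (Y = 3 ∧ (b = 1 ∨ b = 2)) ∧ 3 * (X + 1) ≤ Y) ∨
      (8 ≤ Y ∧ ¬ (b = 0 ∧ Y < 10) ∧ 2 * (X + 1) ≤ Y)) :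
    Nat.log2 (4 * b + Y - 2) + (b * 2 + (b - digitSum b) + X)
      ≤ (4 * b + Y - 2) - digitSum (4 * b + Y - 2) := by
  obtain ⟨M, hM⟩ : ∃ M, M + 2 = 4 * b + Y := ⟨4 * b + Y - 2, by omega⟩
  rw [show 4 * b + Y - 2 = M by omega]
  have h1 := digitSum_le M
  have h2 := digitSum_le b
  by_cases hM64 : M < 64
  · rcases h with ⟨a1, a2, a3, a4⟩ | ⟨a1, a2, a3⟩ | ⟨a1, a2, a3⟩
    · have := numeric_bound_pure M hM64 b (by omega) (by omega)
      omega
    · have := numeric_bound_third M hM64 b (by omega) (by omega) (by omega)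
      omega
    · have := numeric_bound_half M hM64 b (by omega) (by omega) (by omega)
      omega
  · have h3 := log2_le_div M
    have h4 := digitSum_le_log M
    omega

theorem half_excess_numeric_pure : ∀ M < 96, ∀ b < 25, (4 * b = M + 2 ∧ (b = 7 ∨ 9 ≤ b)) →
    (b + 1) / 2 + 2 + digitSum M ≤ b + digitSum b := by
  decide +kernel

theorem half_excess_numeric : ∀ M < 96, ∀ b < 25, 4 * b + 3 ≤ M + 2 → 13 ≤ 2 * b + (M - 4 * b) →
    ((2 * b + (M - 4 * b) + 1) / 2 + 1) / 2 + digitSum M + (M + 2 - 4 * b) / 2 + 1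
      ≤ b + digitSum b + (M + 2 - 4 * b) := by
  decide +kernel

/-- In the finite range, the excess `S` of the rest is replaced by its largest possible value `Y -
2` when the rest is nonzero. -/
theorem half_excess_add_le {b X Y S : ℕ} (hS : S + 2 ≤ Y ∨ (Y = 0 ∧ S = 0)) (h13 : 13 ≤ 2 * b + S)
    (hY : Y ≤ 3 * S)
    (h : (Y = 0 ∧ X = 0 ∧ b ≠ 8) ∨ (3 ≤ Y ∧ 2 * (X + 1) ≤ Y)) :
    ((2 * b + S + 1) / 2 + 1) / 2 + (b * 2 + (b - digitSum b) + X)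
      ≤ (4 * b + Y - 2) - digitSum (4 * b + Y - 2) := by
  obtain ⟨M, hM⟩ : ∃ M, M + 2 = 4 * b + Y := ⟨4 * b + Y - 2, by omega⟩
  rw [show 4 * b + Y - 2 = M by omega]
  have h1 := digitSum_le M
  have h2 := digitSum_le b
  by_cases hM96 : M < 96
  · rcases h with ⟨a1, a2, a3⟩ | ⟨a1, a2⟩
    · have := half_excess_numeric_pure M hM96 b (by omega) (by omega)
      omega
    · have := half_excess_numeric M hM96 b (by omega) (by omega) (by omega)
      omega
  · have h3 := log2_le_div M
    have h4 := digitSum_le_log M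
    omega

theorem eq_single_of_size_eq {r : ℕ+ →₀ ℕ} {i : ℕ+} (hi : r i ≠ 0) (h : size r = i + 1) :
    r = Finsupp.single i 1 := by
  have h1 := sub_single_add hi
  have h2 := congrArg size h1
  rw [map_add, size_single, one_mul, h] at h2
  have h3 : wt (r - Finsupp.single i 1) = 0 := by
    have := size_eq (r - Finsupp.single i 1)
    omega
  rw [wt_eq_zero.1 h3, zero_add] at h1
  exact h1.symm

theorem size_ge_of_ne_single {r : ℕ+ →₀ ℕ} {i : ℕ+} (hi : r i ≠ 0) (h : r ≠ Finsupp.single i 1)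
    (h1 : r 1 = 0) : (i : ℕ) + 4 ≤ size r := by
  have h2 := sub_single_add hi
  set f := r - Finsupp.single i 1 with hf
  have h3 : f ≠ 0 := by
    intro h0; rw [h0, zero_add] at h2; exact h h2.symm
  obtain ⟨j, hj⟩ := Finsupp.ne_iff.1 h3
  have h4 : r j ≠ 0 := by
    intro h0
    apply hj
    rw [hf, Finsupp.tsub_apply, h0, Nat.zero_sub]; rfl
  have h5 := congrArg size (sub_single_add hj)
  have h6 := congrArg size h2
  rw [map_add, size_single] at h5 h6
  have h7 : (j : ℕ) ≠ 1 := by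
    intro hj1
    have : j = 1 := PNat.coe_injective hj1
    subst this; exact h4 h1
  have := j.pos
  omega

theorem eq_single_two {r : ℕ+ →₀ ℕ} (h1 : r 1 = 0) (h : size r = 3) : r = Finsupp.single 2 1 := by
  have h3 : r ≠ 0 := by rintro rfl; simp at h
  obtain ⟨j, hj⟩ := Finsupp.ne_iff.1 h3
  have h5 := congrArg size (sub_single_add hj)
  rw [map_add, size_single] at h5
  have h7 : (j : ℕ) ≠ 1 := by
    intro hj1
    have : j = 1 := PNat.coe_injective hj1
    subst this; exact hj h1
  have := j.pos
  have h8 : j = 2 := PNat.coe_injective (show (j : ℕ) = 2 by omega)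
  subst h8
  exact eq_single_of_size_eq hj h

theorem single_add_erase_three (v : ℕ+ →₀ ℕ) : Finsupp.single 3 (v 3) + v.erase 3 = v :=
  Finsupp.single_add_erase 3 v

theorem padicValNat_gam_eq (v : ℕ+ →₀ ℕ) :
    padicValNat 2 (gam v)
      = v 3 * 2 + (v 3 - digitSum (v 3)) + padicValNat 2 (gam (v.erase 3)) := by
  conv_lhs => rw [← single_add_erase_three v]
  rw [padicValNat_gam_single_add 3 (v 3) _ (by simp)]
  have : padicValNat 2 (((3 : ℕ+) : ℕ) + 1) = 2 := by
    rw [show ((3 : ℕ+) : ℕ) + 1 = 2 ^ 2 by rfl]; exact padicValNat.prime_pow 2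
  rw [this]

theorem size_eq_four_mul (v : ℕ+ →₀ ℕ) : size v = 4 * v 3 + size (v.erase 3) := by
  conv_lhs => rw [← single_add_erase_three v]
  rw [map_add, size_single, show ((3 : ℕ+) : ℕ) = 3 from rfl]; ring

theorem excess_eq_two_mul (v : ℕ+ →₀ ℕ) : excess v = 2 * v 3 + excess (v.erase 3) := by
  conv_lhs => rw [← single_add_erase_three v]
  rw [map_add, excess_single, show ((3 : ℕ+) : ℕ) = 3 from rfl]; ring

/-- By Legendre's formula the right side is `v₂(2^J J!)`, so for `J ≥ 1` this says `v₂(lead v) ≥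
log₂ J + 1`: enough to absorb every denominator `i ≤ J` in `C(l,i) = (l/i) C(l-1,i-1)` with one bit
to spare. -/
theorem log2_add_padicValNat_gam_le {v : ℕ+ →₀ ℕ} (h1 : v 1 = 0)
    (h3 : ∀ e, v = Finsupp.single 3 e → 7 ≤ e ∧ e ≠ 8)
    (h21 : v ≠ Finsupp.single 3 1 + Finsupp.single 2 1)
    (h22 : v ≠ Finsupp.single 3 2 + Finsupp.single 2 1) (h7 : v ≠ Finsupp.single 7 1) :
    Nat.log2 (size v - 2) + padicValNat 2 (gam v) ≤ (size v - 2) - digitSum (size v - 2) := by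
  rw [padicValNat_gam_eq, size_eq_four_mul]
  have hv := single_add_erase_three v
  have e1 : (v.erase 3) 1 = 0 := by rw [Finsupp.erase_ne (by decide), h1]
  have e3 : (v.erase 3) 3 = 0 := Finsupp.erase_same
  set r := v.erase 3
  set b := v 3
  by_cases hr : r = 0
  · rw [hr, add_zero] at hv
    obtain ⟨k1, k2⟩ := h3 b hv.symm
    apply log2_add_le
    left
    rw [hr, map_zero, gam_zero, padicValNat_one_right]
    exact ⟨rfl, rfl, k1, k2⟩
  · obtain ⟨c1, c2, c3, c4, c5⟩ := padicValNat_gam_bound r e1 e3 hr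
    apply log2_add_le
    right
    by_cases hr7 : r 7 = 0
    · left
      refine ⟨c3, ?_, c5 hr7⟩
      rintro ⟨hY, hb⟩
      rw [eq_single_two e1 hY] at hv
      rcases hb with hb | hb
      · rw [hb] at hv; exact h21 hv.symm
      · rw [hb] at hv; exact h22 hv.symm
    · right
      have hsz : 8 ≤ size r := by
        have h5 := congrArg size (sub_single_add hr7)
        rw [map_add, size_single, show ((7 : ℕ+) : ℕ) = 7 from rfl] at h5
        omega
      refine ⟨hsz, ?_, c1⟩
      rintro ⟨hb, hY⟩
      rw [hb, Finsupp.single_zero, zero_add] at hv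
      have h8 := size_ge_of_ne_single hr7 (by rw [hv]; exact h7) e1
      rw [show ((7 : ℕ+) : ℕ) = 7 from rfl] at h8
      omega

/-- Serves vectors with `⌈S/2⌉ ≥ m`: then `v₂(lead v) ≥ ⌈m/2⌉ ≥ N + 1`. The exclusion of `c₃^8` is
genuine, its valuation `3` being one short. -/
theorem half_excess_add_padicValNat_gam_le {v : ℕ+ →₀ ℕ} (h1 : v 1 = 0)
    (h3 : v ≠ Finsupp.single 3 8) (h13 : 13 ≤ excess v) :
    ((excess v + 1) / 2 + 1) / 2 + padicValNat 2 (gam v)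
      ≤ (size v - 2) - digitSum (size v - 2) := by
  rw [padicValNat_gam_eq, size_eq_four_mul]
  rw [excess_eq_two_mul] at h13 ⊢
  have hv := single_add_erase_three v
  have e1 : (v.erase 3) 1 = 0 := by rw [Finsupp.erase_ne (by decide), h1]
  have e3 : (v.erase 3) 3 = 0 := Finsupp.erase_same
  set r := v.erase 3
  set b := v 3
  by_cases hr : r = 0
  · rw [hr, add_zero] at hv
    rw [hr, map_zero] at h13 ⊢
    rw [map_zero, gam_zero, padicValNat_one_right]
    apply half_excess_add_le (Or.inr ⟨rfl, rfl⟩) h13 (by omega)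
    left
    refine ⟨rfl, rfl, ?_⟩
    intro hb
    rw [hb] at hv; exact h3 hv.symm
  · obtain ⟨c1, c2, c3, c4, c5⟩ := padicValNat_gam_bound r e1 e3 hr
    exact half_excess_add_le (Or.inl c2) h13 c4 (Or.inr ⟨c3, c1⟩)

/-! ### Divisibility in `ℤ₍₂₎` and passage to `ℤ₂` -/

/-- `q ∈ 2^M ℤ₍₂₎`. -/
def TwoPowDvd (M : ℕ) (q : ℚ) : Prop := ∃ (a : ℤ) (b : ℕ), Odd b ∧ q * b = 2 ^ M * a

namespace TwoPowDvd

theorem zero (M : ℕ) : TwoPowDvd M 0 := ⟨0, 1, odd_one, by simp⟩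

theorem add {M : ℕ} {p q : ℚ} (hp : TwoPowDvd M p) (hq : TwoPowDvd M q) : TwoPowDvd M (p + q) := by
  obtain ⟨a, b, hb, h⟩ := hp
  obtain ⟨a', b', hb', h'⟩ := hq
  refine ⟨a * b' + a' * b, b * b', hb.mul hb', ?_⟩
  push_cast
  linear_combination (b' : ℚ) * h + (b : ℚ) * h'

theorem neg {M : ℕ} {p : ℚ} (hp : TwoPowDvd M p) : TwoPowDvd M (-p) := by
  obtain ⟨a, b, hb, h⟩ := hp
  refine ⟨-a, b, hb, ?_⟩
  push_cast
  linear_combination -h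

theorem sub {M : ℕ} {p q : ℚ} (hp : TwoPowDvd M p) (hq : TwoPowDvd M q) : TwoPowDvd M (p - q) := by
  rw [sub_eq_add_neg]; exact hp.add hq.neg

theorem mul {M M' : ℕ} {p q : ℚ} (hp : TwoPowDvd M p) (hq : TwoPowDvd M' q) :
    TwoPowDvd (M + M') (p * q) := by
  obtain ⟨a, b, hb, h⟩ := hp
  obtain ⟨a', b', hb', h'⟩ := hq
  refine ⟨a * a', b * b', hb.mul hb', ?_⟩
  push_cast
  rw [pow_add]
  linear_combination (q * b') * h + (2 ^ M * (a : ℚ)) * h'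

theorem mono {M M' : ℕ} {p : ℚ} (h : M ≤ M') (hp : TwoPowDvd M' p) : TwoPowDvd M p := by
  obtain ⟨a, b, hb, h1⟩ := hp
  refine ⟨2 ^ (M' - M) * a, b, hb, ?_⟩
  rw [h1]
  push_cast
  rw [← mul_assoc, ← pow_add, Nat.add_sub_cancel' h]

theorem of_int {M : ℕ} {z : ℤ} (h : (2 : ℤ) ^ M ∣ z) : TwoPowDvd M z := by
  obtain ⟨a, rfl⟩ := h
  exact ⟨a, 1, odd_one, by push_cast; ring⟩

theorem int (z : ℤ) : TwoPowDvd 0 z := of_int (by simp)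

theorem nat (z : ℕ) : TwoPowDvd 0 z := by exact_mod_cast int z

theorem of_nat {M : ℕ} {z : ℕ} (h : 2 ^ M ∣ z) : TwoPowDvd M z := by
  have := of_int (M := M) (z := z) (by exact_mod_cast h)
  exact_mod_cast this

theorem mul_left {M : ℕ} {p q : ℚ} (hp : TwoPowDvd 0 p) (hq : TwoPowDvd M q) :
    TwoPowDvd M (p * q) := by
  simpa using hp.mul hq

theorem mul_right {M : ℕ} {p q : ℚ} (hp : TwoPowDvd M p) (hq : TwoPowDvd 0 q) :
    TwoPowDvd M (p * q) := by
  simpa using hp.mul hq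

theorem sum {ι : Type*} {M : ℕ} (s : Finset ι) (f : ι → ℚ) (h : ∀ i ∈ s, TwoPowDvd M (f i)) :
    TwoPowDvd M (∑ i ∈ s, f i) := by
  classical
  induction s using Finset.induction_on with
  | empty => simpa using zero M
  | insert a s ha ih =>
    rw [Finset.sum_insert ha]
    exact (h a (Finset.mem_insert_self a s)).add
      (ih fun i hi => h i (Finset.mem_insert_of_mem hi))

theorem div_pow {M k : ℕ} {p : ℚ} (h : TwoPowDvd (M + k) p) : TwoPowDvd M (p / 2 ^ k) := by
  obtain ⟨a, b, hb, h⟩ := h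
  refine ⟨a, b, hb, ?_⟩
  rw [pow_add] at h
  field_simp
  linear_combination h

theorem div_odd {M : ℕ} {p : ℚ} {c : ℕ} (hc : Odd c) (h : TwoPowDvd M p) : TwoPowDvd M (p / c) := by
  obtain ⟨a, b, hb, h⟩ := h
  have hc0 : (c : ℚ) ≠ 0 := by exact_mod_cast hc.pos.ne'
  refine ⟨a, b * c, hb.mul hc, ?_⟩
  rw [← h]
  push_cast
  field_simp

theorem of_div {M x y : ℕ} (hy : y ≠ 0) (h : padicValNat 2 y + M ≤ padicValNat 2 x) :
    TwoPowDvd M ((x : ℚ) / y) := by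
  obtain ⟨a, ha⟩ := (pow_dvd_pow 2 h).trans (pow_padicValNat_dvd (p := 2) (n := x))
  obtain ⟨b, hb⟩ := pow_padicValNat_dvd (p := 2) (n := y)
  have hb2 : Odd b := by
    rw [← Nat.not_even_iff_odd, even_iff_two_dvd]
    rintro ⟨c, rfl⟩
    refine pow_succ_padicValNat_not_dvd (p := 2) hy ⟨c, ?_⟩
    rw [pow_succ, mul_assoc]; exact hb
  refine ⟨a, b, hb2, ?_⟩
  have hy' : (y : ℚ) ≠ 0 := by exact_mod_cast hy
  rw [div_mul_eq_mul_div, div_eq_iff hy']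
  rw [pow_add] at ha
  have ha' : (x : ℚ) = 2 ^ padicValNat 2 y * 2 ^ M * a := by exact_mod_cast ha
  have hb' : (y : ℚ) = 2 ^ padicValNat 2 y * b := by exact_mod_cast hb
  push_cast
  linear_combination (b : ℚ) * ha' - (2 ^ M * (a : ℚ)) * hb'

theorem exists_padicInt {M : ℕ} {q : ℚ} (h : TwoPowDvd M q) :
    ∃ z : ℤ_[2], (q : ℚ_[2]) = 2 ^ M * (z : ℚ_[2]) := by
  obtain ⟨a, b, hb, h⟩ := h
  have hb1 : IsUnit (b : ℤ_[2]) := by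
    rw [PadicInt.isUnit_iff, PadicInt.norm_natCast_eq_one_iff]
    exact (Nat.coprime_two_left).2 hb
  obtain ⟨b', hb'⟩ := hb1.exists_right_inv
  refine ⟨a * b', ?_⟩
  have h1 : (q : ℚ_[2]) * b = 2 ^ M * a := by exact_mod_cast h
  have h2 : (b : ℚ_[2]) * (b' : ℚ_[2]) = 1 := by exact_mod_cast congrArg (fun x : ℤ_[2] => (x : ℚ_[2])) hb'
  push_cast
  linear_combination (b' : ℚ_[2]) * h1 - (q : ℚ_[2]) * h2

end TwoPowDvd

/-- Weight exactly `n` rules out every variable beyond `cₙ`, so the quotient assembled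
coefficientwise has the required support. -/
theorem congrModTwoPow_of_coeff {n M : ℕ} {f g : RatPoly}
    (h : ∀ u, TwoPowDvd M (MvPolynomial.coeff u f - MvPolynomial.coeff u g))
    (hw : ∀ u, wt u ≠ n → MvPolynomial.coeff u f - MvPolynomial.coeff u g = 0) :
    CongrModTwoPow n M f g := by
  choose z hz using fun u => (h u).exists_padicInt
  refine ⟨∑ u ∈ (f - g).support, MvPolynomial.monomial u (z u), ?_, ?_⟩
  · refine Subalgebra.sum_mem _ fun u hu => ?_
    have hu' : wt u = n := by
      by_contra hne
      exact MvPolynomial.mem_support_iff.1 hu (by rw [MvPolynomial.coeff_sub]; exact hw u hne)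
    rw [MvPolynomial.mem_supported]
    intro i hi
    obtain ⟨d, hd, hi⟩ := (MvPolynomial.mem_vars_iff_mem_support i).1 hi
    rw [Finset.mem_singleton.1 (MvPolynomial.support_monomial_subset hd),
      Finsupp.mem_support_iff] at hi
    have := le_wt hi
    simp only [Set.mem_ofPred_eq]; omega
  · ext u
    have h2 : (2 : MvPolynomial ℕ+ ℚ_[2]) ^ M = MvPolynomial.C (2 ^ M) := by
      rw [map_pow, map_ofNat]
    rw [h2, MvPolynomial.coeff_C_mul, MvPolynomial.coeff_map, MvPolynomial.coeff_map,
      MvPolynomial.coeff_sum, MvPolynomial.coeff_sub]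
    simp only [MvPolynomial.coeff_monomial, Finset.sum_ite_eq', MvPolynomial.mem_support_iff,
      MvPolynomial.coeff_sub]
    split_ifs with h3
    · exact hz u
    · rw [not_not.1 h3]; simp

/-! ### Differences of binomial coefficients -/

theorem choose_add_sub_choose (y l J : ℕ) :
    ((y + l).choose J : ℚ) - y.choose J
      = ∑ i ∈ Finset.range J, (l.choose (i + 1) : ℚ) * y.choose (J - (i + 1)) := by
  rw [add_comm y l, Nat.add_choose_eq, Finset.Nat.sum_antidiagonal_eq_sum_range_succ
    (fun i j => l.choose i * y.choose j), Finset.sum_range_succ']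
  push_cast
  simp

theorem succ_mul_choose_succ (l i : ℕ) (hl : 0 < l) :
    ((i : ℚ) + 1) * l.choose (i + 1) = l * (l - 1).choose i := by
  obtain ⟨l, rfl⟩ := Nat.exists_eq_succ_of_ne_zero hl.ne'
  have := Nat.add_one_mul_choose_eq l i
  rw [Nat.succ_sub_one]
  have h : ((l + 1) * l.choose i : ℚ) = (l + 1).choose (i + 1) * (i + 1) := by exact_mod_cast this
  push_cast
  linear_combination -h

theorem padicValNat_le_of_lt {i lam : ℕ} (hi : i ≠ 0) (h : i < 2 ^ (lam + 1)) : padicValNat 2 i ≤ lam := by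
  have h1 := Nat.le_of_dvd (by omega) (pow_padicValNat_dvd (p := 2) (n := i))
  have h2 := (Nat.pow_lt_pow_iff_right (a := 2) (by norm_num)).1 (h1.trans_lt h)
  omega

theorem padicValNat_lt_of_ne {i lam : ℕ} (hi : i ≠ 0) (h : i < 2 ^ (lam + 1)) (hne : i ≠ 2 ^ lam) :
    padicValNat 2 i + 1 ≤ lam := by
  have h1 := padicValNat_le_of_lt hi h
  rcases Nat.lt_or_eq_of_le h1 with h2 | h2
  · exact h2
  · exfalso
    obtain ⟨a, ha⟩ := pow_padicValNat_dvd (p := 2) (n := i)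
    rw [h2] at ha
    have : a < 2 := by
      by_contra hc
      have := Nat.mul_le_mul_left (2 ^ lam) (show 2 ≤ a by omega)
      rw [pow_succ] at h
      omega
    interval_cases a <;> omega

/-- In `C(l,i+1) = l/(i+1) * C(l-1,i)` the denominator costs `v₂(i+1)`, which `A` repays with `e`
bits to spare. -/
theorem twoPowDvd_mul_choose {A : ℚ} {e lam N k i : ℕ} (hk : 0 < k) (hi : padicValNat 2 (i + 1) + e ≤ lam)
    (hA : TwoPowDvd lam A) :
    TwoPowDvd (N + e) (A * (k * 2 ^ N).choose (i + 1)) := by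
  have h1 := succ_mul_choose_succ (k * 2 ^ N) i (by positivity)
  have h2 : ((i : ℚ) + 1) ≠ 0 := by positivity
  have h3 : A * (k * 2 ^ N).choose (i + 1)
      = (A / 2 ^ lam) * ((2 ^ lam : ℕ) / (i + 1 : ℕ)) * (((k * 2 ^ N : ℕ) : ℚ) * (k * 2 ^ N - 1).choose i) := by
    rw [← h1]
    push_cast
    field_simp
  rw [h3, add_comm N e]
  refine TwoPowDvd.mul (TwoPowDvd.mul_left ?_ ?_) (TwoPowDvd.mul_right ?_ (TwoPowDvd.nat _))
  · exact TwoPowDvd.div_pow (by simpa using hA)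
  · exact TwoPowDvd.of_div (by omega) (by rw [padicValNat.prime_pow]; exact hi)
  · exact TwoPowDvd.of_nat (Dvd.intro_left k rfl)

theorem twoPowDvd_choose_sub {A : ℚ} {N k J : ℕ} (y : ℕ) (hk : 0 < k)
    (hA : TwoPowDvd (Nat.log2 J + 1) A) :
    TwoPowDvd (N + 1) (A * ((y + k * 2 ^ N).choose J - y.choose J)) := by
  rw [choose_add_sub_choose, Finset.mul_sum]
  refine TwoPowDvd.sum _ _ fun i hi => ?_
  rw [Finset.mem_range] at hi
  rw [← mul_assoc]
  refine (twoPowDvd_mul_choose hk (lam := Nat.log2 J + 1) ?_ hA).mul_right (TwoPowDvd.nat _)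
  have := padicValNat_le_of_lt (lam := Nat.log2 J) (show i + 1 ≠ 0 by omega)
    (lt_of_le_of_lt hi Nat.lt_log2_self)
  omega

/-- `C(k 2^N, j+1)` is even for `0 < j+1 < 2^N`, so by Pascal's rule neighbours in the preceding row
share their parity, starting from `1`. -/
theorem odd_choose_pred {N k j : ℕ} (hk : 0 < k) (hj : j < 2 ^ N) :
    Odd ((k * 2 ^ N - 1).choose j) := by
  induction j with
  | zero => simp
  | succ j ih =>
    have h1 : Even ((k * 2 ^ N).choose (j + 1)) := by
      by_contra hodd
      rw [Nat.not_even_iff_odd] at hodd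
      obtain ⟨t, ht⟩ := hodd
      have h3 := succ_mul_choose_succ (k * 2 ^ N) j (by positivity)
      have h4 : (j + 1) * (k * 2 ^ N).choose (j + 1) = 2 ^ N * (k * (k * 2 ^ N - 1).choose j) := by
        have : ((j + 1) * (k * 2 ^ N).choose (j + 1) : ℚ)
            = 2 ^ N * (k * (k * 2 ^ N - 1).choose j) := by
          rw [h3]; push_cast; ring
        exact_mod_cast this
      have h5 : 2 ^ N ∣ j + 1 := by
        refine (Nat.Coprime.dvd_of_dvd_mul_right ?_ ⟨_, h4⟩)
        exact Nat.Coprime.pow_left _ ((Nat.coprime_two_left).2 ⟨t, ht⟩)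
      have := Nat.le_of_dvd (by omega) h5
      omega
    have h6 : (k * 2 ^ N).choose (j + 1)
        = (k * 2 ^ N - 1).choose j + (k * 2 ^ N - 1).choose (j + 1) := by
      have : 0 < k * 2 ^ N := by positivity
      conv_lhs => rw [show k * 2 ^ N = (k * 2 ^ N - 1) + 1 by omega]
      rw [Nat.choose_succ_succ]
    have h7 := ih (by omega)
    rw [h6] at h1
    rw [← Nat.not_even_iff_odd] at h7 ⊢
    rw [Nat.even_add] at h1
    tauto

theorem twoPowDvd_odd_sub_one {z : ℕ} (hz : Odd z) : TwoPowDvd 1 ((z : ℚ) - 1) := by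
  obtain ⟨t, rfl⟩ := hz
  exact ⟨t, 1, odd_one, by push_cast; ring⟩

/-- The difference of binomial coefficients when only the term `C(l, 2^lam)` survives. -/
theorem twoPowDvd_choose_sub_sub {A : ℚ} {N k J lam : ℕ} (y : ℕ) (hk : 0 < k)
    (hA : TwoPowDvd 1 (A / 2 ^ lam - 1)) (h1 : 2 ^ lam ≤ J) (h2 : J < 2 ^ (lam + 1)) (hlam : lam ≤ N) :
    TwoPowDvd (N + 1) (A * ((y + k * 2 ^ N).choose J - y.choose J)
      - (k * 2 ^ N : ℕ) * y.choose (J - 2 ^ lam)) := by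
  have hpos : 0 < 2 ^ lam := by positivity
  have hA0 : TwoPowDvd 0 (A / 2 ^ lam) := by
    have := (hA.mono (Nat.zero_le 1)).add (TwoPowDvd.int 1)
    simpa using this
  have hA' : TwoPowDvd lam A := by
    have := hA0.mul (TwoPowDvd.of_nat (dvd_refl (2 ^ lam)))
    push_cast at this
    rw [zero_add, div_mul_cancel₀ _ (by positivity)] at this
    exact this
  have hmem : 2 ^ lam - 1 ∈ Finset.range J := Finset.mem_range.2 (by omega)
  rw [choose_add_sub_choose, Finset.mul_sum, ← Finset.add_sum_erase _ _ hmem, add_sub_right_comm]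
  refine TwoPowDvd.add ?_ (TwoPowDvd.sum _ _ fun i hi => ?_)
  · rw [Nat.sub_add_cancel hpos, ← mul_assoc, ← sub_mul]
    refine TwoPowDvd.mul_right ?_ (TwoPowDvd.nat _)
    have h3 := succ_mul_choose_succ (k * 2 ^ N) (2 ^ lam - 1) (by positivity)
    rw [Nat.sub_add_cancel hpos, Nat.cast_sub hpos, Nat.cast_one, sub_add_cancel] at h3
    -- Since `2^lam C(l, 2^lam) = l C(l-1, 2^lam - 1)` and both cofactors of `l` are odd, this term
    -- is `l` modulo `2^(N+1)`.
    have h4 : A * (k * 2 ^ N).choose (2 ^ lam) - (k * 2 ^ N : ℕ)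
        = (k * 2 ^ N : ℕ) * ((A / 2 ^ lam - 1) * (k * 2 ^ N - 1).choose (2 ^ lam - 1)
          + ((k * 2 ^ N - 1).choose (2 ^ lam - 1) - 1)) := by
      have h5 : ((2 ^ lam : ℕ) : ℚ) ≠ 0 := by positivity
      have h6 : A = A / 2 ^ lam * (2 ^ lam : ℕ) := by
        push_cast; field_simp
      conv_lhs => rw [h6]
      rw [mul_assoc, h3]
      ring
    rw [h4]
    refine TwoPowDvd.mul (TwoPowDvd.of_nat (Dvd.intro_left k rfl)) (TwoPowDvd.add ?_ ?_)
    · exact hA.mul_right (TwoPowDvd.nat _)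
    · refine twoPowDvd_odd_sub_one (odd_choose_pred hk ?_)
      have := Nat.pow_le_pow_right (show 0 < 2 by norm_num) hlam
      omega
  -- Every other index below `2^(lam+1)` has valuation less than `lam`, hence a spare factor 2.
  · rw [Finset.mem_erase, Finset.mem_range] at hi
    rw [← mul_assoc]
    refine (twoPowDvd_mul_choose hk (lam := lam) ?_ hA').mul_right (TwoPowDvd.nat _)
    exact padicValNat_lt_of_ne (Nat.succ_ne_zero i) (by omega) (by omega)

/-! ### Products of consecutive odd numbers -/

/-- The product `(2y+1)(2y+3)⋯(2y+2j-1)`. -/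
def oddProd (y : ℕ) : ℕ → ℕ
  | 0 => 1
  | j + 1 => oddProd y j * (2 * (y + j) + 1)

theorem oddProd_add (y i j : ℕ) : oddProd y (i + j) = oddProd y i * oddProd (y + i) j := by
  induction j with
  | zero => simp [oddProd]
  | succ j ih =>
    rw [← add_assoc, oddProd, ih, oddProd, mul_assoc, add_assoc]

theorem odd_oddProd (y j : ℕ) : Odd (oddProd y j) := by
  induction j with
  | zero => exact odd_one
  | succ j ih => exact ih.mul ⟨_, rfl⟩

/-- The derivative of `oddProd y j` with respect to `2y`. -/
def oddProdDeriv (y : ℕ) : ℕ → ℕ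
  | 0 => 0
  | j + 1 => oddProdDeriv y j * (2 * (y + j) + 1) + oddProd y j

theorem oddProd_shift (y h j : ℕ) : ∃ R, oddProd (y + h) j
    = oddProd y j + 2 * h * oddProdDeriv y j + (2 * h) ^ 2 * R := by
  induction j with
  | zero => exact ⟨0, by simp [oddProd, oddProdDeriv]⟩
  | succ j ih =>
    obtain ⟨R, hR⟩ := ih
    refine ⟨R * (2 * (y + j) + 1) + oddProdDeriv y j + 2 * h * R, ?_⟩
    rw [oddProd, hR, oddProd, oddProdDeriv]
    ring

theorem oddProdDeriv_add (y i j : ℕ) : oddProdDeriv y (i + j)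
    = oddProdDeriv y i * oddProd (y + i) j + oddProd y i * oddProdDeriv (y + i) j := by
  induction j with
  | zero => simp [oddProd, oddProdDeriv]
  | succ j ih =>
    rw [← add_assoc, oddProdDeriv, ih, oddProdDeriv, oddProd, oddProd_add, ← add_assoc]
    ring

theorem oddProd_modEq {m y z : ℕ} (h : y ≡ z [MOD m]) (j : ℕ) : oddProd y j ≡ oddProd z j [MOD m] := by
  induction j with
  | zero => rfl
  | succ j ih => exact ih.mul (((h.add_right j).mul_left 2).add_right 1)

theorem oddProdDeriv_modEq {m y z : ℕ} (h : y ≡ z [MOD m]) (j : ℕ) :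
    oddProdDeriv y j ≡ oddProdDeriv z j [MOD m] := by
  induction j with
  | zero => rfl
  | succ j ih =>
    exact (ih.mul (((h.add_right j).mul_left 2).add_right 1)).add (oddProd_modEq h j)

/-- The factor 16 makes the linear Taylor term for a shift by `2^N` divisible by `2^(N+5)`, as the
doubling in `exists_oddProd_two_pow` requires. -/
theorem oddProdDeriv_eight (y : ℕ) : 16 ∣ oddProdDeriv y 8 := by
  have h : ∀ z < 16, oddProdDeriv z 8 % 16 = 0 := by decide
  have h1 := oddProdDeriv_modEq (Nat.mod_modEq y 16) 8
  exact (Nat.modEq_zero_iff_dvd).1 (h1.symm.trans (h (y % 16) (Nat.mod_lt _ (by norm_num))))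

theorem dvd_oddProdDeriv (y i : ℕ) : 16 ∣ oddProdDeriv y (i * 8) := by
  induction i with
  | zero => exact ⟨0, by simp [oddProdDeriv]⟩
  | succ i ih =>
    rw [add_mul, one_mul, oddProdDeriv_add]
    exact dvd_add (ih.mul_right _) ((oddProdDeriv_eight _).mul_left _)

/-- `(oddProd y 8 - 1) / 16` modulo `8`. -/
def oddProdQuot (y : ℕ) : ℕ := oddProd (y % 8) 8 / 16 % 8

theorem oddProd_eight (y : ℕ) : oddProd y 8 ≡ 1 + 16 * oddProdQuot y [MOD 128] := by
  have h : ∀ z < 64, oddProd z 8 % 128 = (1 + 16 * oddProdQuot z) % 128 := by decide +kernel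
  have h1 : oddProd y 8 ≡ oddProd (y % 64) 8 [MOD 128] := by
    obtain ⟨R, hR⟩ := oddProd_shift (y % 64) (64 * (y / 64)) 8
    rw [Nat.mod_add_div] at hR
    rw [hR]
    have : 128 ∣ 2 * (64 * (y / 64)) * oddProdDeriv (y % 64) 8 + (2 * (64 * (y / 64))) ^ 2 * R :=
      ⟨y / 64 * oddProdDeriv (y % 64) 8 + 128 * (y / 64) ^ 2 * R, by ring⟩
    rw [add_assoc]
    obtain ⟨t, ht⟩ := this
    rw [ht]
    simp [Nat.ModEq]
  have h2 : oddProdQuot (y % 64) = oddProdQuot y := by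
    rw [oddProdQuot, oddProdQuot, Nat.mod_mod_of_dvd y (by norm_num)]
  rw [← h2]
  exact h1.trans (h (y % 64) (Nat.mod_lt _ (by norm_num)))

theorem oddProdQuot_add (y t : ℕ) : oddProdQuot (y + 8 * t) = oddProdQuot y := by
  rw [oddProdQuot, oddProdQuot, Nat.add_mul_mod_self_left]

/-- Doubling: the second half of the product is the first shifted by `2^N`, equal to it modulo
`2^(N+5)`. Squaring raises both exponents of 2 by one, and the quadratic terms carry `2^(2N+2)`,
harmless for `N ≥ 3`. -/
theorem exists_oddProd_two_pow (N : ℕ) (hN : 3 ≤ N) : ∀ y : ℕ, ∃ t : ℤ,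
    (oddProd y (2 ^ N) : ℤ) = 1 + 2 ^ (N + 1) * oddProdQuot y + 2 ^ (N + 4) * t := by
  induction N, hN using Nat.le_induction with
  | base =>
    intro y
    have h := (Nat.modEq_iff_dvd.1 (oddProd_eight y).symm)
    obtain ⟨t, ht⟩ := h
    refine ⟨t, ?_⟩
    push_cast at ht
    norm_num
    linarith
  | succ N hN ih =>
    intro y
    obtain ⟨t, ht⟩ := ih y
    obtain ⟨R, hR⟩ := oddProd_shift y (2 ^ N) (2 ^ N)
    obtain ⟨M, rfl⟩ := Nat.exists_eq_add_of_le' hN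
    obtain ⟨s, hs⟩ := dvd_oddProdDeriv y (2 ^ M)
    rw [show 2 ^ M * 8 = 2 ^ (M + 3) by rw [pow_add]; norm_num] at hs
    have h1 : oddProd y (2 ^ (M + 3 + 1))
        = oddProd y (2 ^ (M + 3)) * oddProd (y + 2 ^ (M + 3)) (2 ^ (M + 3)) := by
      rw [← oddProd_add]; congr 1; rw [pow_succ]; ring
    have hR' : (oddProd (y + 2 ^ (M + 3)) (2 ^ (M + 3)) : ℤ)
        = oddProd y (2 ^ (M + 3)) + 2 * 2 ^ (M + 3) * (16 * s) + (2 * 2 ^ (M + 3)) ^ 2 * R := by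
      rw [hs] at hR; exact_mod_cast hR
    rw [h1]
    push_cast
    rw [hR', ht]
    set q : ℤ := ((oddProdQuot y : ℕ) : ℤ)
    set a : ℤ := 2 ^ M
    rw [show (2 : ℤ) ^ (M + 3 + 1) = 16 * a by rw [pow_add, pow_add]; ring,
      show (2 : ℤ) ^ (M + 3 + 4) = 128 * a by rw [pow_add, pow_add]; ring,
      show (2 : ℤ) ^ (M + 3 + 1 + 1) = 32 * a by rw [pow_add, pow_add, pow_add]; ring,
      show (2 : ℤ) ^ (M + 3 + 1 + 4) = 256 * a by rw [pow_add, pow_add, pow_add]; ring,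
      show (2 : ℤ) ^ (M + 3) = 8 * a by rw [pow_add]; ring]
    refine ⟨t + a * (q + 8 * t) ^ 2 + (1 + 16 * a * q + 128 * a * t) * (s + a * R), ?_⟩
    ring

theorem exists_oddProd_mul_two_pow (N : ℕ) (hN : 3 ≤ N) (y k : ℕ) : ∃ t : ℤ,
    (oddProd y (k * 2 ^ N) : ℤ) = 1 + 2 ^ (N + 1) * (k * oddProdQuot y) + 2 ^ (N + 4) * t := by
  obtain ⟨M, rfl⟩ := Nat.exists_eq_add_of_le' hN
  induction k with
  | zero => exact ⟨0, by simp [oddProd]⟩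
  | succ k ih =>
    obtain ⟨t, ht⟩ := ih
    obtain ⟨s, hs⟩ := exists_oddProd_two_pow (M + 3) hN (y + k * 2 ^ (M + 3))
    rw [show y + k * 2 ^ (M + 3) = y + 8 * (k * 2 ^ M) by rw [pow_add]; ring, oddProdQuot_add,
      show y + 8 * (k * 2 ^ M) = y + k * 2 ^ (M + 3) by rw [pow_add]; ring] at hs
    rw [add_mul, one_mul, oddProd_add, Nat.cast_mul, ht, hs]
    set q : ℤ := ((oddProdQuot y : ℕ) : ℤ)
    set a : ℤ := 2 ^ M
    rw [show (2 : ℤ) ^ (M + 3 + 1) = 16 * a by rw [pow_add, pow_add]; ring,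
      show (2 : ℤ) ^ (M + 3 + 4) = 128 * a by rw [pow_add, pow_add]; ring]
    refine ⟨t + s + 2 * a * (k * q + 8 * t) * (q + 8 * s), ?_⟩
    push_cast
    ring

/-- `(2y-1)!! = 1 · 3 ⋯ (2y-1)`. -/
def oddFact (y : ℕ) : ℕ := oddProd 0 y

theorem oddFact_add (y j : ℕ) : oddFact (y + j) = oddFact y * oddProd y j := by
  rw [oddFact, oddFact, oddProd_add, zero_add]

theorem odd_oddFact (y : ℕ) : Odd (oddFact y) := odd_oddProd 0 y

theorem oddFact_succ (y : ℕ) : oddFact (y + 1) = oddFact y * (2 * y + 1) := by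
  rw [oddFact, oddProd, zero_add, oddFact]

/-- Any 32 consecutive odd numbers run through the units modulo 64, whose product is `1`. -/
theorem oddFact_mod (y : ℕ) : oddFact y ≡ oddFact (y % 32) [MOD 64] := by
  have h1 : ∀ z : ℕ, oddProd z 32 ≡ 1 [MOD 64] := by
    intro z
    have h : ∀ z < 32, oddProd z 32 % 64 = 1 := by decide +kernel
    obtain ⟨R, hR⟩ := oddProd_shift (z % 32) (32 * (z / 32)) 32
    rw [Nat.mod_add_div] at hR
    have h2 := h (z % 32) (Nat.mod_lt _ (by norm_num))
    have h3 : 2 * (32 * (z / 32)) * oddProdDeriv (z % 32) 32 + (2 * (32 * (z / 32))) ^ 2 * R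
      = 64 * (z / 32 * oddProdDeriv (z % 32) 32 + 64 * (z / 32) ^ 2 * R) := by ring
    rw [hR, add_assoc, h3, Nat.ModEq, Nat.add_mul_mod_self_left, h2]
  have h2 : ∀ t z : ℕ, oddFact (z + 32 * t) ≡ oddFact z [MOD 64] := by
    intro t z
    induction t with
    | zero => rfl
    | succ t ih =>
      rw [mul_add, mul_one, ← add_assoc, oddFact_add]
      simpa using ih.mul (h1 (z + 32 * t))
  have := h2 (y / 32) (y % 32)
  rwa [Nat.mod_add_div] at this

theorem factorial_eq_oddFact (x : ℕ) : x ! = oddFact ((x + 1) / 2) * (2 ^ (x / 2) * (x / 2)!) := by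
  have h : ∀ y, (2 * y)! = oddFact y * (2 ^ y * y !) := by
    intro y
    induction y with
    | zero => rfl
    | succ y ih =>
      rw [show 2 * (y + 1) = 2 * y + 1 + 1 by ring, Nat.factorial_succ, Nat.factorial_succ, ih,
        oddFact_succ, Nat.factorial_succ]
      ring
  rcases Nat.even_or_odd' x with ⟨y, rfl | rfl⟩
  · rw [h, show (2 * y + 1) / 2 = y by omega, show 2 * y / 2 = y by omega]
  · rw [Nat.factorial_succ, h, show (2 * y + 1 + 1) / 2 = y + 1 by omega,
      show (2 * y + 1) / 2 = y by omega, oddFact_succ]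
    ring

theorem doubleFactorial_eq_oddFact (y : ℕ) : (2 * y + 1)‼ = oddFact (y + 1) := by
  induction y with
  | zero => rfl
  | succ y ih =>
    rw [show 2 * (y + 1) + 1 = 2 * y + 1 + 2 by ring, Nat.doubleFactorial_add_two, ih,
      oddFact_succ (y + 1)]
    ring

/-! ### The coefficients as functions of `n`, and their generic periodicity -/

/-- The coefficient in `B̂ₙ/n` of the monomial `c₁^{n - wt v} c^v`, where `v 1 = 0`. -/
noncomputable def tau (v : ℕ+ →₀ ℕ) (n : ℕ) : ℚ :=
  if wt v ≤ n then (-1) ^ (n + excess v + 1) * ((2 * n - 2 - excess v)! : ℚ)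
    / (2 ^ (n - wt v) * (n - wt v)! * gam v) else 0

theorem single_add_erase_one (u : ℕ+ →₀ ℕ) : Finsupp.single 1 (u 1) + u.erase 1 = u :=
  Finsupp.single_add_erase 1 u

theorem neg_one_pow_congr {a b : ℕ} (h : (a + b) % 2 = 0) : (-1 : ℚ) ^ a = (-1) ^ b := by
  rcases Nat.even_or_odd a with ha | ha
  · rw [ha.neg_one_pow, Even.neg_one_pow]
    rw [Nat.even_iff] at *; omega
  · rw [ha.neg_one_pow, Odd.neg_one_pow]
    rw [Nat.odd_iff] at *; omega

theorem coeff_dividedBernoulli_eq_tau {n : ℕ} (hn : 2 ≤ n) {u : ℕ+ →₀ ℕ} (hu : wt u = n) :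
    MvPolynomial.coeff u (dividedBernoulli n) = tau (u.erase 1) n := by
  rw [coeff_dividedBernoulli n hn, if_pos hu]
  have h1 := congrArg wt (single_add_erase_one u)
  have h2 := congrArg Finsupp.degree (single_add_erase_one u)
  rw [map_add, wt_single, PNat.one_coe, mul_one, hu] at h1
  rw [map_add, Finsupp.degree_single] at h2
  have h3 := wt_eq (u.erase 1)
  have h4 : gam u = 2 ^ (u 1) * (u 1)! * gam (u.erase 1) := by
    rw [gam_erase u 1, PNat.one_coe]
  rw [tau, if_pos (by omega), h4, show n - wt (u.erase 1) = u 1 by omega,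
    show n - 2 + u.degree = 2 * n - 2 - excess (u.erase 1) by omega,
    neg_one_pow_congr (b := n + excess (u.erase 1) + 1) (by omega)]
  push_cast
  rfl

theorem coeff_pow_mul_dividedBernoulli {l m n : ℕ} (hm : 2 ≤ m) (hn : n = m + l)
    {u : ℕ+ →₀ ℕ} (hu : wt u = n) :
    MvPolynomial.coeff u (c 1 ^ l * dividedBernoulli m) = tau (u.erase 1) m := by
  have h1 := congrArg wt (single_add_erase_one u)
  rw [map_add, wt_single, PNat.one_coe, mul_one, hu] at h1
  rw [c, MvPolynomial.X_pow_eq_monomial, MvPolynomial.coeff_monomial_mul', one_mul]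
  simp only [Finsupp.single_le_iff]
  split_ifs with h
  · have h2 : u - Finsupp.single 1 l + Finsupp.single 1 l = u :=
      tsub_add_cancel_of_le (Finsupp.single_le_iff.2 h)
    have h3 := congrArg wt h2
    rw [map_add, wt_single, PNat.one_coe, mul_one, hu] at h3
    rw [coeff_dividedBernoulli_eq_tau hm (by omega)]
    congr 1
    ext j
    by_cases hj : j = 1
    · subst hj; simp
    · simp [Finsupp.erase_ne hj, Finsupp.single_eq_of_ne hj]
  -- A `c₁`-exponent below `l` means `wt v > m`, where the default value `0` of `tau` is the true
  -- coefficient.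
  · rw [tau, if_neg (by omega)]

theorem coeff_pow_mul_dividedBernoulli_eq_zero {l m n : ℕ} (hm : 2 ≤ m) (hn : n = m + l)
    {u : ℕ+ →₀ ℕ} (hu : wt u ≠ n) :
    MvPolynomial.coeff u (c 1 ^ l * dividedBernoulli m) = 0 := by
  rw [c, MvPolynomial.X_pow_eq_monomial, MvPolynomial.coeff_monomial_mul', one_mul]
  simp only [Finsupp.single_le_iff]
  split_ifs with h
  · have h2 : u - Finsupp.single 1 l + Finsupp.single 1 l = u :=
      tsub_add_cancel_of_le (Finsupp.single_le_iff.2 h)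
    have h3 := congrArg wt h2
    rw [map_add, wt_single, PNat.one_coe, mul_one] at h3
    rw [coeff_dividedBernoulli m hm, if_neg (by omega)]
  · rfl

/-- The 2-adically relevant part `2^J J! / γ(v)` of `tau v n`. -/
noncomputable def lead (v : ℕ+ →₀ ℕ) : ℚ :=
  ((2 ^ ((size v - 2) / 2) * ((size v - 2) / 2)! : ℕ) : ℚ) / (gam v : ℚ)

theorem size_bound {v : ℕ+ →₀ ℕ} (h0 : v ≠ 0) (h1 : v 1 = 0) :
    3 ≤ size v ∧ excess v + 2 ≤ size v ∧ 1 ≤ excess v := by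
  obtain ⟨j, hj⟩ := Finsupp.ne_iff.1 h0
  have h7 : (j : ℕ) ≠ 1 := by
    intro hj1
    have : j = 1 := PNat.coe_injective hj1
    subst this; exact hj h1
  have := j.pos
  have h5 := congrArg size (sub_single_add hj)
  have h6 := congrArg excess (sub_single_add hj)
  rw [map_add, size_single] at h5
  rw [map_add, excess_single] at h6
  have h8 := size_eq (v - Finsupp.single j 1)
  have h9 := wt_eq (v - Finsupp.single j 1)
  omega

/-- With `A = n-1-⌈S/2⌉`, the even factors make up `2^A A!`, and `n - wt v = A - J`; the quotient is
`2^J J! C(A,J)`. If `wt v > n` then `A < J` and both sides vanish. -/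
theorem tau_eq {v : ℕ+ →₀ ℕ} (h0 : v ≠ 0) (h1 : v 1 = 0) {n : ℕ} (hn : (excess v + 1) / 2 + 1 ≤ n) :
    tau v n = (-1) ^ (n + excess v + 1) * oddFact (n - 1 - excess v / 2) *
      (lead v * (n - 1 - (excess v + 1) / 2).choose ((size v - 2) / 2)) := by
  obtain ⟨b1, b2, b3⟩ := size_bound h0 h1
  have h3 := size_eq v
  have h4 := wt_eq v
  rw [tau]
  split_ifs with h
  · rw [factorial_eq_oddFact, show (2 * n - 2 - excess v + 1) / 2 = n - 1 - excess v / 2 by omega,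
      show (2 * n - 2 - excess v) / 2 = n - 1 - (excess v + 1) / 2 by omega]
    have h5 := Nat.choose_mul_factorial_mul_factorial
      (show (size v - 2) / 2 ≤ n - 1 - (excess v + 1) / 2 by omega)
    rw [show n - 1 - (excess v + 1) / 2 - (size v - 2) / 2 = n - wt v by omega] at h5
    have h6 : (2 : ℚ) ^ (n - 1 - (excess v + 1) / 2) = 2 ^ (n - wt v) * 2 ^ ((size v - 2) / 2) := by
      rw [← pow_add]; congr 1; omega
    rw [lead, ← h5]
    push_cast
    rw [h6]
    have hg : (gam v : ℚ) ≠ 0 := by exact_mod_cast (gam_pos v).ne'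
    have hf : ((n - wt v)! : ℚ) ≠ 0 := by positivity
    field_simp
  · rw [Nat.choose_eq_zero_of_lt (by omega)]; simp

theorem padicValNat_two_pow_mul_factorial (M : ℕ) :
    padicValNat 2 (2 ^ (M / 2) * (M / 2)!) = M - digitSum M := by
  rw [padicValNat.mul (by positivity) (by positivity), padicValNat.prime_pow,
    padicValNat_factorial_two]
  have h1 := digitSum_bit (M % 2) (M / 2) (by omega)
  rw [show M % 2 + 2 * (M / 2) = M by omega] at h1
  have := digitSum_le (M / 2)
  omega

theorem twoPowDvd_lead {v : ℕ+ →₀ ℕ} {e : ℕ}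
    (h : e + padicValNat 2 (gam v) ≤ (size v - 2) - digitSum (size v - 2)) :
    TwoPowDvd e (lead v) := by
  refine TwoPowDvd.of_div (gam_pos v).ne' ?_
  rw [padicValNat_two_pow_mul_factorial]; omega

theorem twoPowDvd_neg_one_pow (a : ℕ) : TwoPowDvd 0 ((-1 : ℚ) ^ a) := by
  have := TwoPowDvd.int ((-1) ^ a)
  push_cast at this
  exact this

theorem twoPowDvd_oddFact_sub {N k : ℕ} (hN : 3 ≤ N) (y : ℕ) :
    TwoPowDvd (N + 1) ((oddFact (y + k * 2 ^ N) : ℚ) - oddFact y) := by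
  obtain ⟨t, ht⟩ := exists_oddProd_mul_two_pow N hN y k
  have h : (((oddFact (y + k * 2 ^ N) : ℤ) - oddFact y : ℤ) : ℚ)
      = (oddFact (y + k * 2 ^ N) : ℚ) - oddFact y := by push_cast; rfl
  rw [← h]
  apply TwoPowDvd.of_int
  refine ⟨oddFact y * (k * oddProdQuot y + 8 * t), ?_⟩
  rw [oddFact_add]
  push_cast
  rw [ht, show N + 4 = N + 1 + 3 by ring, pow_add (2 : ℤ) (N + 1) 3]
  ring

/-- Reduces to the binomial factor: the signed odd factor is periodic modulo `2^(N+1)`, and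
multiplying `t`, already divisible by `2^N`, by an odd number does not change it modulo `2^(N+1)`.
-/
theorem twoPowDvd_tau_sub_sub {N k m : ℕ} (hN : 3 ≤ N) {v : ℕ+ →₀ ℕ} (h0 : v ≠ 0) (h1 : v 1 = 0)
    (hm : (excess v + 1) / 2 + 1 ≤ m) {z : ℤ} {t : ℚ} (ht : TwoPowDvd N t)
    (hl : TwoPowDvd 0 (lead v))
    (h : TwoPowDvd (N + 1) (lead v * ((m - 1 - (excess v + 1) / 2 + k * 2 ^ N).choose ((size v - 2) / 2)
      - (m - 1 - (excess v + 1) / 2).choose ((size v - 2) / 2)) - t * z)) :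
    TwoPowDvd (N + 1) (tau v (m + k * 2 ^ N) - tau v m - t * z) := by
  obtain ⟨M, rfl⟩ := Nat.exists_eq_add_of_le' hN
  rw [tau_eq h0 h1 hm, tau_eq h0 h1 (by omega),
    neg_one_pow_congr (a := m + k * 2 ^ (M + 3) + excess v + 1) (b := m + excess v + 1)
      (by rw [show k * 2 ^ (M + 3) = 2 * (k * 2 ^ (M + 2)) by ring]; omega)]
  rw [show m + k * 2 ^ (M + 3) - 1 - excess v / 2 = m - 1 - excess v / 2 + k * 2 ^ (M + 3) by omega,
    show m + k * 2 ^ (M + 3) - 1 - (excess v + 1) / 2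
      = m - 1 - (excess v + 1) / 2 + k * 2 ^ (M + 3) by omega]
  set y := m - 1 - excess v / 2
  set x := m - 1 - (excess v + 1) / 2
  set J := (size v - 2) / 2
  set ε : ℚ := (-1) ^ (m + excess v + 1) with hε
  have hε0 : TwoPowDvd 0 ε := twoPowDvd_neg_one_pow _
  have hε1 : TwoPowDvd 1 (ε * oddFact y - 1) := by
    obtain ⟨s, hs⟩ := odd_oddFact y
    rcases neg_one_pow_eq_or ℚ (m + excess v + 1) with h' | h'
    · exact ⟨s, 1, odd_one, by rw [hε, h', hs]; push_cast; ring⟩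
    · exact ⟨-s - 1, 1, odd_one, by rw [hε, h', hs]; push_cast; ring⟩
  have key : ε * oddFact (y + k * 2 ^ (M + 3)) * (lead v * (x + k * 2 ^ (M + 3)).choose J)
      - ε * oddFact y * (lead v * x.choose J) - t * z
      = ε * oddFact y * (lead v * ((x + k * 2 ^ (M + 3)).choose J - x.choose J) - t * z)
        + ((oddFact (y + k * 2 ^ (M + 3)) : ℚ) - oddFact y)
          * (ε * (lead v * (x + k * 2 ^ (M + 3)).choose J))
        + t * (ε * oddFact y - 1) * z := by ring
  rw [key]
  refine TwoPowDvd.add (TwoPowDvd.add ?_ ?_) ?_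
  · exact (hε0.mul_left (TwoPowDvd.nat _)).mul_left h
  · exact (twoPowDvd_oddFact_sub (by omega) y).mul_right
      (hε0.mul_left (hl.mul_left (TwoPowDvd.nat _)))
  · exact (ht.mul hε1).mul_right (TwoPowDvd.int z)

theorem log2_half (M : ℕ) (h : 2 ≤ M) : Nat.log2 (M / 2) + 1 = Nat.log2 M := by
  conv_rhs => rw [Nat.log2_def, if_pos (by omega)]

theorem twoPowDvd_tau_sub_of_log2_le {N k m : ℕ} (hN : 3 ≤ N) (hk : 0 < k) {v : ℕ+ →₀ ℕ} (h0 : v ≠ 0)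
    (h1 : v 1 = 0) (hm : (excess v + 1) / 2 + 1 ≤ m)
    (h : Nat.log2 (size v - 2) + padicValNat 2 (gam v) ≤ (size v - 2) - digitSum (size v - 2)) :
    TwoPowDvd (N + 1) (tau v (m + k * 2 ^ N) - tau v m) := by
  have hA := twoPowDvd_lead h
  have := twoPowDvd_tau_sub_sub (k := k) hN h0 h1 hm (z := 0) (t := 0) (TwoPowDvd.zero N)
    (hA.mono (Nat.zero_le _)) ?_
  · simpa using this
  · rw [zero_mul, sub_zero]
    by_cases hs : 2 ≤ size v - 2
    · apply twoPowDvd_choose_sub _ hk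
      rwa [log2_half _ hs]
    · rw [show (size v - 2) / 2 = 0 by omega]
      simpa using TwoPowDvd.zero _

theorem twoPowDvd_tau_of_le {M : ℕ} {v : ℕ+ →₀ ℕ} (h0 : v ≠ 0) (h1 : v 1 = 0)
    (h : TwoPowDvd M (lead v)) (n : ℕ) : TwoPowDvd M (tau v n) := by
  obtain ⟨b1, b2, b3⟩ := size_bound h0 h1
  have h3 := size_eq v
  have h4 := wt_eq v
  by_cases hn : (excess v + 1) / 2 + 1 ≤ n
  · rw [tau_eq h0 h1 hn]
    exact TwoPowDvd.mul_left ((twoPowDvd_neg_one_pow _).mul_left (TwoPowDvd.nat _))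
      (h.mul_right (TwoPowDvd.nat _))
  · rw [tau, if_neg (by omega)]
    exact TwoPowDvd.zero _

/-- Beyond the range of `tau_eq` periodicity is not needed: `2N+1 ≤ m ≤ ⌈S/2⌉` makes each
coefficient vanish modulo `2^(N+1)` separately. -/
theorem twoPowDvd_tau_sub_of_lt {N k m : ℕ} (hN : 3 ≤ N) (hm : 2 * N + 1 ≤ m) {v : ℕ+ →₀ ℕ}
    (h1 : v 1 = 0) (h3 : v ≠ Finsupp.single 3 8) (hv : m < (excess v + 1) / 2 + 1) :
    TwoPowDvd (N + 1) (tau v (m + k * 2 ^ N) - tau v m) := by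
  have h0 : v ≠ 0 := by rintro rfl; rw [map_zero] at hv; omega
  have h := half_excess_add_padicValNat_gam_le h1 h3 (by omega)
  have hA := (twoPowDvd_lead h).mono (M := N + 1) (by omega)
  exact (twoPowDvd_tau_of_le h0 h1 hA _).sub (twoPowDvd_tau_of_le h0 h1 hA _)

/-- For all but finitely many `v` the coefficient only depends on `n` modulo `2^N`. -/
theorem twoPowDvd_tau_sub {N k m : ℕ} (hN : 3 ≤ N) (hk : 0 < k) (hm : 2 * N + 1 ≤ m) {v : ℕ+ →₀ ℕ}
    (h1 : v 1 = 0) (h3 : ∀ e, v = Finsupp.single 3 e → 7 ≤ e ∧ e ≠ 8)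
    (h21 : v ≠ Finsupp.single 3 1 + Finsupp.single 2 1)
    (h22 : v ≠ Finsupp.single 3 2 + Finsupp.single 2 1) (h7 : v ≠ Finsupp.single 7 1) :
    TwoPowDvd (N + 1) (tau v (m + k * 2 ^ N) - tau v m) := by
  by_cases hv : (excess v + 1) / 2 + 1 ≤ m
  · refine twoPowDvd_tau_sub_of_log2_le hN hk ?_ h1 hv (log2_add_padicValNat_gam_le h1 h3 h21 h22 h7)
    rintro rfl
    have := h3 0 (by simp)
    omega
  · exact twoPowDvd_tau_sub_of_lt hN hm h1 (fun h => (h3 8 h).2 rfl) (by omega)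

/-! ### Exceptional monomials with one surviving binomial term -/

theorem odd_choose_bit (x j : ℕ) :
    x.choose (2 * j + 1) % 2 = (x % 2) * ((x / 2).choose j % 2) % 2 := by
  have h := Choose.choose_modEq_choose_mod_mul_choose_div_nat (p := 2) (n := x) (k := 2 * j + 1)
  rw [show (2 * j + 1) % 2 = 1 by omega, show (2 * j + 1) / 2 = j by omega, Nat.choose_one_right] at h
  rw [h, Nat.mul_mod, Nat.mod_mod]

theorem choose_three_mod_two (x : ℕ) : x.choose 3 % 2 = if x % 4 = 3 then 1 else 0 := by
  rw [show 3 = 2 * 1 + 1 by rfl, odd_choose_bit, Nat.choose_one_right]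
  have := Nat.mod_two_eq_zero_or_one x
  have := Nat.mod_two_eq_zero_or_one (x / 2)
  split_ifs with h
  · rw [show x % 2 = 1 by omega, show x / 2 % 2 = 1 by omega]
  · rcases this with h1 | h1
    · rw [h1]; simp
    · rw [h1, show x % 2 = 0 by omega]

theorem choose_seven_mod_two (x : ℕ) : x.choose 7 % 2 = if x % 8 = 7 then 1 else 0 := by
  rw [show 7 = 2 * 3 + 1 by rfl, odd_choose_bit, choose_three_mod_two]
  split_ifs <;> omega

theorem choose_fifteen_mod_two (x : ℕ) : x.choose 15 % 2 = if x % 16 = 15 then 1 else 0 := by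
  rw [show 15 = 2 * 7 + 1 by rfl, odd_choose_bit, choose_seven_mod_two]
  split_ifs <;> omega

/-- The borderline case `v₂(lead v) = ⌊log₂ J⌋ = lam`: the change is `l C(m-s, J-2^lam)`, of which
only the parity `b` matters. -/
theorem twoPowDvd_tau_simple {N k m lam s x b : ℕ} (hN : 3 ≤ N) (hk : 0 < k) {v : ℕ+ →₀ ℕ} (h0 : v ≠ 0)
    (h1 : v 1 = 0) {J : ℕ} (hs : (excess v + 1) / 2 + 1 = s) (hm : s ≤ m) (hJ : (size v - 2) / 2 = J)
    (hA : TwoPowDvd 1 (lead v / 2 ^ lam - 1)) (hJ1 : 2 ^ lam ≤ J) (hJ2 : J < 2 ^ (lam + 1))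
    (hlam : lam ≤ 3) (hx : x = m - s) (hb : x.choose (J - 2 ^ lam) % 2 = b) :
    TwoPowDvd (N + 1) (tau v (m + k * 2 ^ N) - tau v m - (k * 2 ^ N : ℕ) * (b : ℚ)) := by
  have hl : TwoPowDvd N ((k * 2 ^ N : ℕ) : ℚ) := TwoPowDvd.of_nat (Dvd.intro_left k rfl)
  have hA0 : TwoPowDvd 0 (lead v) := by
    have := ((hA.mono (Nat.zero_le 1)).add (TwoPowDvd.int 1)).mul_left (TwoPowDvd.nat (2 ^ lam))
    have e : ((2 ^ lam : ℕ) : ℚ) * (lead v / 2 ^ lam - 1 + (1 : ℤ)) = lead v := by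
      push_cast; field_simp; ring
    rwa [mul_comm, e] at this
  have h := twoPowDvd_choose_sub_sub (N := N) (k := k) x hk hA hJ1 hJ2 (by omega)
  have h2 := twoPowDvd_tau_sub_sub (k := k) (m := m) hN h0 h1 (by omega) (t := (k * 2 ^ N : ℕ))
    (z := (x.choose (J - 2 ^ lam) : ℤ)) hl hA0
    (by rw [hJ, show m - 1 - (excess v + 1) / 2 = x by omega]; exact_mod_cast h)
  have h3 : TwoPowDvd (N + 1) ((k * 2 ^ N : ℕ) * ((x.choose (J - 2 ^ lam) : ℚ) - b)) := by
    obtain ⟨q, hq⟩ : ∃ q, x.choose (J - 2 ^ lam) = b + 2 * q :=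
      ⟨x.choose (J - 2 ^ lam) / 2, by omega⟩
    refine hl.mul ⟨q, 1, odd_one, ?_⟩
    rw [hq]; push_cast; ring
  have h4 := h2.add h3
  push_cast at h4 ⊢
  ring_nf at h4 ⊢
  exact h4

theorem lead_single (i : ℕ+) (e : ℕ) : lead (Finsupp.single i e)
    = ((2 ^ ((e * (i + 1) - 2) / 2) * ((e * (i + 1) - 2) / 2)! : ℕ) : ℚ) / ((i + 1) ^ e * e ! : ℕ) := by
  rw [lead, size_single, gam_single]

theorem lead_single_add (e : ℕ) : lead (Finsupp.single 3 e + Finsupp.single 2 1)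
    = ((2 ^ ((e * 4 + 3 - 2) / 2) * ((e * 4 + 3 - 2) / 2)! : ℕ) : ℚ) / (4 ^ e * e ! * 3 : ℕ) := by
  rw [lead, gam_single_add _ _ _ (by simp), gam_single, map_add, size_single, size_single]
  simp

theorem tau_c_three_five {N k m : ℕ} (hN : 3 ≤ N) (hk : 0 < k) (hm : 2 * N + 1 ≤ m) :
    TwoPowDvd (N + 1) (tau (Finsupp.single 3 5) (m + k * 2 ^ N) - tau (Finsupp.single 3 5) m
      - (k * 2 ^ N : ℕ) * ((m % 2 : ℕ) : ℚ)) := by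
  refine twoPowDvd_tau_simple hN hk (lam := 3) (s := 6) (J := 9) (by simp) (by simp)
    (by rw [excess_single]; rfl) (by omega) (by rw [size_single]; rfl) ?_
    (by norm_num) (by norm_num) le_rfl rfl ?_
  · rw [lead_single]
    -- Here `lead = 1512 = 8 * 189` and `(189 - 1) / 2 = 94`; the later witnesses arise the same
    -- way.
    refine ⟨94, 1, odd_one, ?_⟩
    norm_num [Nat.factorial]
  · rw [show 9 - 2 ^ 3 = 1 by norm_num, Nat.choose_one_right]; omega

theorem tau_c_three_six {N k m : ℕ} (hN : 3 ≤ N) (hk : 0 < k) (hm : 2 * N + 1 ≤ m) :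
    TwoPowDvd (N + 1) (tau (Finsupp.single 3 6) (m + k * 2 ^ N) - tau (Finsupp.single 3 6) m
      - (k * 2 ^ N : ℕ) * ((if m % 4 = 2 then 1 else 0 : ℕ) : ℚ)) := by
  refine twoPowDvd_tau_simple hN hk (lam := 3) (s := 7) (J := 11) (by simp) (by simp)
    (by rw [excess_single]; rfl) (by omega) (by rw [size_single]; rfl) ?_
    (by norm_num) (by norm_num) le_rfl rfl ?_
  · rw [lead_single]
    refine ⟨1732, 1, odd_one, ?_⟩
    norm_num [Nat.factorial]
  · rw [show 11 - 2 ^ 3 = 3 by norm_num, choose_three_mod_two]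
    split_ifs <;> omega

theorem tau_c_seven {N k m : ℕ} (hN : 3 ≤ N) (hk : 0 < k) (hm : 2 * N + 1 ≤ m) :
    TwoPowDvd (N + 1) (tau (Finsupp.single 7 1) (m + k * 2 ^ N) - tau (Finsupp.single 7 1) m
      - (k * 2 ^ N : ℕ) * ((m % 2 : ℕ) : ℚ)) := by
  refine twoPowDvd_tau_simple hN hk (lam := 1) (s := 4) (J := 3) (by simp) (by simp)
    (by rw [excess_single]; rfl) (by omega) (by rw [size_single]; rfl) ?_
    (by norm_num) (by norm_num) (by norm_num) rfl ?_
  · rw [lead_single]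
    refine ⟨1, 1, odd_one, ?_⟩
    norm_num [Nat.factorial]
  · rw [show 3 - 2 ^ 1 = 1 by norm_num, Nat.choose_one_right]; omega

theorem tau_c_two_c_three {N k m : ℕ} (hN : 3 ≤ N) (hk : 0 < k) (hm : 2 * N + 1 ≤ m) :
    TwoPowDvd (N + 1) (tau (Finsupp.single 3 1 + Finsupp.single 2 1) (m + k * 2 ^ N)
      - tau (Finsupp.single 3 1 + Finsupp.single 2 1) m - (k * 2 ^ N : ℕ) * ((1 : ℕ) : ℚ)) := by
  refine twoPowDvd_tau_simple hN hk (lam := 1) (s := 3) (J := 2)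
    (by intro h; simpa using DFunLike.congr_fun h 3) (by simp)
    (by rw [map_add, excess_single, excess_single]; rfl) (by omega)
    (by rw [map_add, size_single, size_single]; rfl) ?_
    (by norm_num) (by norm_num) (by norm_num) rfl ?_
  · rw [lead_single_add]
    refine ⟨-1, 3, by decide, ?_⟩
    norm_num [Nat.factorial]
  · simp

theorem tau_c_two_c_three_sq {N k m : ℕ} (hN : 3 ≤ N) (hk : 0 < k) (hm : 2 * N + 1 ≤ m) :
    TwoPowDvd (N + 1) (tau (Finsupp.single 3 2 + Finsupp.single 2 1) (m + k * 2 ^ N)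
      - tau (Finsupp.single 3 2 + Finsupp.single 2 1) m - (k * 2 ^ N : ℕ) * ((1 : ℕ) : ℚ)) := by
  refine twoPowDvd_tau_simple hN hk (lam := 2) (s := 4) (J := 4)
    (by intro h; simpa using DFunLike.congr_fun h 3) (by simp)
    (by rw [map_add, excess_single, excess_single]; rfl) (by omega)
    (by rw [map_add, size_single, size_single]; rfl) ?_
    (by norm_num) (by norm_num) (by norm_num) rfl ?_
  · rw [lead_single_add]
    refine ⟨0, 1, odd_one, ?_⟩
    norm_num [Nat.factorial]
  · simp

theorem tau_c_three_eight {N k m : ℕ} (hN : 3 ≤ N) (hk : Odd k) (hm : 2 * N + 1 ≤ m) :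
    TwoPowDvd (N + 1) (tau (Finsupp.single 3 8) (m + k * 2 ^ N) - tau (Finsupp.single 3 8) m
      - (k * 2 ^ N : ℕ) * ((if m % 8 = 0 ∧ m ≠ 8 then 1 else 0 : ℕ) : ℚ)) := by
  have hlead : lead (Finsupp.single 3 8) = 16216200 := by
    rw [lead_single]; norm_num [Nat.factorial]
  by_cases h9 : 9 ≤ m
  · refine twoPowDvd_tau_simple hN hk.pos (lam := 3) (s := 9) (J := 15) (by simp) (by simp)
      (by rw [excess_single]; rfl) (by omega) (by rw [size_single]; rfl) ?_
      (by norm_num) (by norm_num) le_rfl rfl ?_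
    · rw [hlead]
      refine ⟨1013512, 1, odd_one, ?_⟩
      norm_num
    · rw [show 15 - 2 ^ 3 = 7 by norm_num, choose_seven_mod_two]
      split_ifs <;> omega
  -- Now `m` is 7 or 8. The coefficient at `m` is zero because `24 > m`; at `m + l` the upper index
  -- is `m - 1` modulo 16 as `k` is odd, so `C(·,15)` is even and adds the missing bit to `v₂(lead
  -- v) = 3`.
  · have hN3 : N = 3 := by omega
    subst hN3
    obtain ⟨j, rfl⟩ := hk
    rw [if_neg (by omega)]
    have h1 : tau (Finsupp.single 3 8) m = 0 := by
      rw [tau, if_neg]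
      rw [wt_single, show ((3 : ℕ+) : ℕ) = 3 from rfl]; omega
    rw [h1, tau_eq (by simp) (by simp)
      (by rw [excess_single, show ((3 : ℕ+) : ℕ) = 3 from rfl]; omega), hlead, excess_single,
      size_single, show ((3 : ℕ+) : ℕ) = 3 from rfl]
    have h2 := choose_fifteen_mod_two (m + (2 * j + 1) * 2 ^ 3 - 1 - (8 * (3 - 1) + 1) / 2)
    rw [if_neg (by omega)] at h2
    rw [show (8 * (3 + 1) - 2) / 2 = 15 by norm_num, Nat.cast_zero, mul_zero, sub_zero, sub_zero]
    refine TwoPowDvd.mul_left ((twoPowDvd_neg_one_pow _).mul_left (TwoPowDvd.nat _)) ?_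
    have h3 : TwoPowDvd 3 (16216200 : ℚ) := ⟨2027025, 1, odd_one, by norm_num⟩
    exact h3.mul (TwoPowDvd.of_nat (M := 1) (by rw [pow_one]; exact Nat.dvd_of_mod_eq_zero h2))

/-! ### The powers `c₃^e` with `1 ≤ e ≤ 4` -/

/-- The falling factorial `y(y-1)⋯(y-j+1)`. -/
def fall (y : ℤ) : ℕ → ℤ
  | 0 => 1
  | j + 1 => fall y j * (y - j)

/-- The divided difference `(fall (y+l) j - fall y j) / l`. -/
def fallDiff (y l : ℤ) : ℕ → ℤ
  | 0 => 0
  | j + 1 => fallDiff y l j * (y + l - j) + fall y j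

theorem fall_add (y l : ℤ) (j : ℕ) : fall (y + l) j = fall y j + l * fallDiff y l j := by
  induction j with
  | zero => simp [fall, fallDiff]
  | succ j ih => rw [fall, fall, fallDiff, ih]; ring

theorem cast_descFactorial (y j : ℕ) : (y.descFactorial j : ℤ) = fall y j := by
  induction j with
  | zero => simp [fall]
  | succ j ih =>
    rw [Nat.descFactorial_succ, fall, ← ih]
    by_cases h : j ≤ y
    · push_cast [Nat.cast_sub h]; ring
    · rw [Nat.descFactorial_of_lt (by omega)]; simp

theorem fall_modEq {m y z : ℤ} (h : y ≡ z [ZMOD m]) (j : ℕ) : fall y j ≡ fall z j [ZMOD m] := by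
  induction j with
  | zero => rfl
  | succ j ih => exact ih.mul (h.sub_right _)

theorem fallDiff_modEq {m y z l l' : ℤ} (h : y ≡ z [ZMOD m]) (hl : l ≡ l' [ZMOD m]) (j : ℕ) :
    fallDiff y l j ≡ fallDiff z l' j [ZMOD m] := by
  induction j with
  | zero => rfl
  | succ j ih => exact (ih.mul ((h.add hl).sub_right _)).add (fall_modEq h j)

/-- The variation of `oddFact y * fall y j` along `l`, divided by `l`. -/
def variation (y l j : ℕ) : ℤ :=
  oddFact y * (fallDiff y l j + 2 * oddProdQuot y * fall ((y : ℤ) + l) j)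

theorem variation_modEq (y l j : ℕ) :
    variation y l j ≡ variation (y % 32) (l % 32) j [ZMOD 32] := by
  have h1 : ((oddFact y : ℕ) : ℤ) ≡ (oddFact (y % 32) : ℕ) [ZMOD 32] :=
    Int.natCast_modEq_iff.2 ((oddFact_mod y).of_dvd (by norm_num))
  have h2 : (y : ℤ) ≡ ((y % 32 : ℕ) : ℤ) [ZMOD 32] :=
    Int.natCast_modEq_iff.2 (Nat.mod_modEq y 32).symm
  have h3 : (l : ℤ) ≡ ((l % 32 : ℕ) : ℤ) [ZMOD 32] :=
    Int.natCast_modEq_iff.2 (Nat.mod_modEq l 32).symm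
  have h4 : oddProdQuot (y % 32) = oddProdQuot y := by
    rw [oddProdQuot, oddProdQuot, Nat.mod_mod_of_dvd y (by norm_num)]
  rw [variation, variation, h4]
  exact h1.mul ((fallDiff_modEq h2 h3 j).add ((fall_modEq (h2.add h3) j).mul_left _))

/-- The error keeps its factor `fall`, because for `e = 4` precision `2^(N+4)` is one bit short and
the evenness of `fall` supplies it. -/
theorem oddFact_mul_fall_sub {N : ℕ} (hN : 3 ≤ N) (y k j : ℕ) : ∃ t : ℤ,
    (oddFact (y + k * 2 ^ N) : ℤ) * fall ((y + k * 2 ^ N : ℕ) : ℤ) j - oddFact y * fall y j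
      = 2 ^ N * k * variation y (k * 2 ^ N) j
        + 2 ^ N * (16 * fall ((y + k * 2 ^ N : ℕ) : ℤ) j) * t := by
  obtain ⟨t, ht⟩ := exists_oddProd_mul_two_pow N hN y k
  refine ⟨oddFact y * t, ?_⟩
  have h := fall_add y ((k * 2 ^ N : ℕ) : ℤ) j
  rw [oddFact_add, variation, Nat.cast_mul, ht, Nat.cast_add, h, pow_add (2 : ℤ) N 1,
    pow_add (2 : ℤ) N 4]
  push_cast
  ring

theorem tau_single_three {e : ℕ} (he : 0 < e) {m : ℕ} (hm : e + 1 ≤ m) :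
    tau (Finsupp.single 3 e) m = (-1) ^ (m + 1) * (oddFact (m - 1 - e) * fall ((m - 1 - e : ℕ) : ℤ) (2 * e - 1) : ℤ)
      / (2 * e ! : ℕ) := by
  rw [tau_eq (by simp; omega) (by simp) (by rw [excess_single, show ((3 : ℕ+) : ℕ) = 3 from rfl]; omega),
    lead_single, excess_single, size_single, show ((3 : ℕ+) : ℕ) = 3 from rfl,
    show (e * (3 + 1) - 2) / 2 = 2 * e - 1 by omega, show e * (3 - 1) / 2 = e by omega,
    show (e * (3 - 1) + 1) / 2 = e by omega,
    neg_one_pow_congr (a := m + e * (3 - 1) + 1) (b := m + 1) (by omega), ← cast_descFactorial,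
    Nat.descFactorial_eq_factorial_mul_choose]
  have h1 : ((2 : ℚ) ^ (2 * e - 1)) * 2 = 4 ^ e := by
    rw [← pow_succ, show 2 * e - 1 + 1 = 2 * e by omega, pow_mul]; norm_num
  have h2 : (e ! : ℚ) ≠ 0 := by positivity
  push_cast
  rw [← h1]
  field_simp

theorem twoPowDvd_tau_three {N k m e a d : ℕ} (hN : 3 ≤ N) (he : 0 < e) (hm : e + 1 ≤ m)
    (hd : 2 * e ! = 2 ^ a * d) (hdo : Odd d) {s : ℤ} {ε : ℤ} (hε : (-1) ^ (m + 1) = ε)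
    (h1 : (2 : ℤ) ^ (a + 1) ∣ ε * variation (m - 1 - e) (k * 2 ^ N) (2 * e - 1) - s)
    (h2 : (2 : ℤ) ^ (a + 1) ∣ 16 * fall ((m - 1 - e + k * 2 ^ N : ℕ) : ℤ) (2 * e - 1)) :
    TwoPowDvd (N + 1) (tau (Finsupp.single 3 e) (m + k * 2 ^ N) - tau (Finsupp.single 3 e) m
      - (k * 2 ^ N : ℕ) * ((s : ℚ) / (2 * e ! : ℕ))) := by
  obtain ⟨t, ht⟩ := oddFact_mul_fall_sub hN (m - 1 - e) k (2 * e - 1)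
  rw [tau_single_three he hm, tau_single_three he (by omega),
    neg_one_pow_congr (a := m + k * 2 ^ N + 1) (b := m + 1)
      (by
        obtain ⟨M, rfl⟩ := Nat.exists_eq_add_of_le' hN
        rw [show k * 2 ^ (M + 3) = 2 * (k * 2 ^ (M + 2)) by ring]; omega),
    show m + k * 2 ^ N - 1 - e = m - 1 - e + k * 2 ^ N by omega]
  set y := m - 1 - e
  have hε' : (-1 : ℚ) ^ (m + 1) = ε := by rw [← hε]; push_cast; rfl
  have hz : TwoPowDvd (N + (a + 1)) ((2 ^ N * (k * (ε * variation y (k * 2 ^ N) (2 * e - 1) - s)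
      + 16 * fall ((y + k * 2 ^ N : ℕ) : ℤ) (2 * e - 1) * (ε * t)) : ℤ) : ℚ) := by
    apply TwoPowDvd.of_int
    rw [pow_add]
    exact mul_dvd_mul_left _ (dvd_add (h1.mul_left _) (h2.mul_right _))
  have hz2 := (TwoPowDvd.div_pow (M := N + 1) (k := a) (by
    rwa [show N + 1 + a = N + (a + 1) by ring])).div_odd (c := d) hdo (p := _)
  have hd' : ((2 * e ! : ℕ) : ℚ) = 2 ^ a * d := by rw [hd]; push_cast; rfl
  rw [hε', hd']
  convert hz2 using 1
  have hdo' : (d : ℚ) ≠ 0 := by exact_mod_cast hdo.pos.ne'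
  have ht' := congrArg (Int.cast : ℤ → ℚ) ht
  field_simp
  push_cast at ht' ⊢
  linear_combination (ε : ℚ) * ht'

theorem two_dvd_fall (y : ℤ) {j : ℕ} (h : 2 ≤ j) : 2 ∣ fall y j := by
  induction j, h using Nat.le_induction with
  | base =>
    simp only [fall]
    have := Int.even_mul_pred_self y
    rw [← even_iff_two_dvd]; push_cast; simpa using this
  | succ j hj ih => exact ih.mul_right _

/-- The sign `(-1)^{(m+1)/2}` for odd `m`. -/
def oddSign (m : ℕ) : ℤ := if m % 4 = 3 then 1 else -1

theorem neg_one_pow_half {m : ℕ} (h : m % 2 = 1) : (-1 : ℚ) ^ ((m + 1) / 2) = oddSign m := by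
  rw [oddSign]
  split_ifs with h1
  · rw [Even.neg_one_pow (Nat.even_iff.2 (by omega))]; norm_num
  · rw [Odd.neg_one_pow (Nat.odd_iff.2 (by omega))]; norm_num

/-- The sign `(-1)^{m+1}`. -/
def succSign (m : ℕ) : ℤ := if m % 2 = 1 then 1 else -1

theorem neg_one_pow_succ (m : ℕ) : (-1 : ℤ) ^ (m + 1) = succSign m := by
  rw [succSign]
  split_ifs with h1
  · rw [Even.neg_one_pow (Nat.even_iff.2 (by omega))]
  · rw [Odd.neg_one_pow (Nat.odd_iff.2 (by omega))]

/-- The numerators of the coefficients of `c₃^e` over `2 e!`. -/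
def numThree (e m : ℕ) (b : Bool) : ℤ :=
  match e with
  | 1 => if m % 2 = 1 then oddSign m else if m % 4 = 2 then -1 else 1
  | 2 => if m % 2 = 1 then 2 * oddSign m else if m % 4 = 2 then 3 else 1
  | 3 => if m % 2 = 1 then 6 * oddSign m else if m % 4 = 2 then 12 else 0
  | 4 => if m % 2 = 1 then 48 else if m % 4 = 2 then (if b then -24 else 24)
      else if m % 8 = 4 then 12 else 60
  | _ => 0

theorem numThree_add (e y t : ℕ) (b : Bool) : numThree e (y + 8 * t) b = numThree e y b := by
  have h2 : (y + 8 * t) % 2 = y % 2 := by omega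
  have h4 : (y + 8 * t) % 4 = y % 4 := by omega
  have h8 : (y + 8 * t) % 8 = y % 8 := by omega
  simp only [numThree, oddSign, h2, h4, h8]

theorem variation_table_one : ∀ y < 32, ∀ j < 4,
    (succSign (y + 2) * variation y (8 * j) 1 - numThree 1 (y + 2) (j % 2 == 1)) % 4 = 0 := by
  decide +kernel

theorem variation_table_two : ∀ y < 32, ∀ j < 4,
    (succSign (y + 3) * variation y (8 * j) 3 - numThree 2 (y + 3) (j % 2 == 1)) % 8 = 0 := by
  decide +kernel

theorem variation_table_three : ∀ y < 32, ∀ j < 4,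
    (succSign (y + 4) * variation y (8 * j) 5 - numThree 3 (y + 4) (j % 2 == 1)) % 8 = 0 := by
  decide +kernel

theorem variation_table_four : ∀ y < 32, ∀ j < 4,
    (succSign (y + 5) * variation y (8 * j) 7 - numThree 4 (y + 5) (j % 2 == 1)) % 32 = 0 := by
  decide +kernel

/-- Dividing by `2 e! = 2^a d` costs `a` bits, so the variation is needed modulo `2^(a+1)`, a
divisor of 32, and depends on `y` and `l = 8j` modulo 32. As `k` is odd, `j` is odd exactly when `N
= 3`; this is the origin of `θ`. -/
theorem twoPowDvd_tau_three_of_table {N k m e a d : ℕ} (hN : 3 ≤ N) (hk : Odd k) (he : 0 < e)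
    (hm : e + 1 ≤ m) (hd : 2 * e ! = 2 ^ a * d) (hdo : Odd d) (ha : a ≤ 4) (ha2 : a ≤ 3 ∨ 2 ≤ e)
    (htab : ∀ y < 32, ∀ j < 4, (succSign (y + (e + 1)) * variation y (8 * j) (2 * e - 1)
      - numThree e (y + (e + 1)) (j % 2 == 1)) % 2 ^ (a + 1) = 0) :
    TwoPowDvd (N + 1) (tau (Finsupp.single 3 e) (m + k * 2 ^ N) - tau (Finsupp.single 3 e) m
      - (k * 2 ^ N : ℕ) * ((numThree e m (N == 3) : ℚ) / (2 * e ! : ℕ))) := by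
  refine twoPowDvd_tau_three hN he hm hd hdo (neg_one_pow_succ m) ?_ ?_
  · set y := m - 1 - e with hy
    have hj : ∃ j < 4, (k * 2 ^ N) % 32 = 8 * j ∧ (j % 2 == 1) = (N == 3) := by
      obtain ⟨M, rfl⟩ := Nat.exists_eq_add_of_le' hN
      refine ⟨k * 2 ^ M % 4, Nat.mod_lt _ (by norm_num), ?_, ?_⟩
      · rw [show k * 2 ^ (M + 3) = 8 * (k * 2 ^ M) by ring]; omega
      · rcases M with _ | M
        · obtain ⟨r, rfl⟩ := hk
          simp only [pow_zero, mul_one]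
          rw [show (2 * r + 1) % 4 % 2 = 1 by omega]; rfl
        · rw [show k * 2 ^ (M + 1) = 2 * (k * 2 ^ M) by ring,
            show 2 * (k * 2 ^ M) % 4 % 2 = 0 by omega]
          symm
          simp
    obtain ⟨j, hj4, hj1, hj2⟩ := hj
    have h1 := htab (y % 32) (Nat.mod_lt _ (by norm_num)) j hj4
    rw [hj2] at h1
    have h2 := variation_modEq y (k * 2 ^ N) (2 * e - 1)
    rw [hj1] at h2
    have h3 : numThree e m (N == 3) = numThree e (y % 32 + (e + 1)) (N == 3) := by
      rw [← numThree_add e (y % 32 + (e + 1)) (4 * (y / 32))]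
      congr 1
      omega
    have h4 : succSign m = succSign (y % 32 + (e + 1)) := by
      rw [succSign, succSign, show (y % 32 + (e + 1)) % 2 = m % 2 by omega]
    rw [h3, h4]
    have h5 : (2 : ℤ) ^ (a + 1) ∣ 32 := by
      rw [show (32 : ℤ) = 2 ^ 5 by norm_num]; exact pow_dvd_pow _ (by omega)
    have h6 := ((h2.of_dvd h5).mul_left (succSign (y % 32 + (e + 1)))).sub_right
      (numThree e (y % 32 + (e + 1)) (N == 3))
    exact (Int.modEq_zero_iff_dvd).1 (h6.trans h1)
  · rcases ha2 with h | h
    · refine Dvd.dvd.mul_right ?_ _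
      rw [show (16 : ℤ) = 2 ^ 4 by norm_num]; exact pow_dvd_pow _ (by omega)
    · refine (pow_dvd_pow 2 (show a + 1 ≤ 4 + 1 by omega)).trans ?_
      rw [pow_succ]
      exact mul_dvd_mul (by norm_num) (two_dvd_fall _ (by omega))

theorem tau_c_three_one {N k m : ℕ} (hN : 3 ≤ N) (hk : Odd k) (hm : 2 * N + 1 ≤ m) :
    TwoPowDvd (N + 1) (tau (Finsupp.single 3 1) (m + k * 2 ^ N) - tau (Finsupp.single 3 1) m
      - (k * 2 ^ N : ℕ) * ((numThree 1 m (N == 3) : ℚ) / 2)) := by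
  simpa using twoPowDvd_tau_three_of_table (e := 1) (a := 1) (d := 1) hN hk (by omega) (by omega)
    (by decide) (by decide) (by omega) (by omega) variation_table_one

theorem tau_c_three_two {N k m : ℕ} (hN : 3 ≤ N) (hk : Odd k) (hm : 2 * N + 1 ≤ m) :
    TwoPowDvd (N + 1) (tau (Finsupp.single 3 2) (m + k * 2 ^ N) - tau (Finsupp.single 3 2) m
      - (k * 2 ^ N : ℕ) * ((numThree 2 m (N == 3) : ℚ) / 4)) :=
  twoPowDvd_tau_three_of_table (e := 2) (a := 2) (d := 1) hN hk (by omega) (by omega)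
    (by decide) (by decide) (by omega) (by omega) variation_table_two

theorem tau_c_three_three {N k m : ℕ} (hN : 3 ≤ N) (hk : Odd k) (hm : 2 * N + 1 ≤ m) :
    TwoPowDvd (N + 1) (tau (Finsupp.single 3 3) (m + k * 2 ^ N) - tau (Finsupp.single 3 3) m
      - (k * 2 ^ N : ℕ) * ((numThree 3 m (N == 3) : ℚ) / 12)) :=
  twoPowDvd_tau_three_of_table (e := 3) (a := 2) (d := 3) hN hk (by omega) (by omega)
    (by decide) (by decide) (by omega) (by omega) variation_table_three

theorem tau_c_three_four {N k m : ℕ} (hN : 3 ≤ N) (hk : Odd k) (hm : 2 * N + 1 ≤ m) :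
    TwoPowDvd (N + 1) (tau (Finsupp.single 3 4) (m + k * 2 ^ N) - tau (Finsupp.single 3 4) m
      - (k * 2 ^ N : ℕ) * ((numThree 4 m (N == 3) : ℚ) / 48)) :=
  twoPowDvd_tau_three_of_table (e := 4) (a := 4) (d := 3) hN hk (by omega) (by omega)
    (by decide) (by decide) (by omega) (by omega) variation_table_four

/-! ### The pure power `c₁^n` -/

theorem tau_zero {m : ℕ} (hm : 1 ≤ m) :
    tau 0 m = succSign m * oddFact (m - 1) / (2 * m : ℕ) := by
  rw [tau, if_pos (by simp), map_zero, map_zero, gam_zero, factorial_eq_oddFact,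
    show (2 * m - 2 - 0 + 1) / 2 = m - 1 by omega, show (2 * m - 2 - 0) / 2 = m - 1 by omega,
    ← neg_one_pow_succ]
  obtain ⟨m, rfl⟩ := Nat.exists_eq_add_of_le' hm
  simp only [Nat.add_sub_cancel, Nat.sub_zero, add_zero]
  rw [Nat.factorial_succ]
  have : (m ! : ℚ) ≠ 0 := by positivity
  push_cast
  field_simp
  ring

/-- The variation of `oddFact (m - 1) / m`, cleared of denominators. -/
def variationZero (m : ℕ) : ℤ := oddFact (m - 1) * (2 * oddProdQuot (m - 1) * m - 1)

theorem variationZero_modEq (y : ℕ) : variationZero (y + 1) ≡ variationZero (y % 32 + 1) [ZMOD 64] := by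
  simp only [variationZero, Nat.add_sub_cancel]
  have h1 : ((oddFact y : ℕ) : ℤ) ≡ (oddFact (y % 32) : ℕ) [ZMOD 64] :=
    Int.natCast_modEq_iff.2 (oddFact_mod y)
  have h4 : oddProdQuot (y % 32) = oddProdQuot y := by
    rw [oddProdQuot, oddProdQuot, Nat.mod_mod_of_dvd y (by norm_num)]
  have h2 : 2 * ((oddProdQuot y : ℕ) : ℤ) * ((y + 1 : ℕ) : ℤ)
      ≡ 2 * ((oddProdQuot y : ℕ) : ℤ) * ((y % 32 + 1 : ℕ) : ℤ) [ZMOD 64] := by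
    generalize oddProdQuot y = q
    obtain ⟨z, r, hr, hy⟩ : ∃ z r, y % 32 = r ∧ y = 32 * z + r := ⟨y / 32, _, rfl, by omega⟩
    rw [hr, hy, Int.modEq_iff_dvd]
    exact ⟨-(q : ℤ) * z, by push_cast; ring⟩
  rw [h4]
  exact h1.mul (h2.sub_right 1)

/-- The moduli 4, 16, 64 are twice the 2-part of `2mn` in each class; to this precision the `m²`
terms may later be replaced by `mn`. -/
theorem variationZero_table : ∀ y < 32,
    ((y + 1) % 2 = 1 → (variationZero (y + 1) + oddSign (y + 1) * ((y + 1) * (y + 1))) % 4 = 0) ∧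
    ((y + 1) % 4 = 2 → (variationZero (y + 1) + 2 * ((y + 1) * (y + 1)) + 1) % 16 = 0) ∧
    ((y + 1) % 8 = 4 → (variationZero (y + 1) + 2 * ((y + 1) * (y + 1)) - 1) % 64 = 0) := by
  decide +kernel

/-- Over the common denominator `2mn = 2^a d` the numerator is, up to sign, `l * variationZero m`
plus a multiple of `2^(N+4) m`; hence the two divisibility conditions modulo `2^(a+1)`. -/
theorem twoPowDvd_tau_zero {N k m a d : ℕ} (hN : 3 ≤ N) (hm : 1 ≤ m)
    (hd : 2 * m * (m + k * 2 ^ N) = 2 ^ a * d) (hdo : Odd d) {s : ℤ}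
    (h1 : (2 : ℤ) ^ (a + 1) ∣ succSign m * variationZero m - s)
    (h2 : (2 : ℤ) ^ (a + 1) ∣ 16 * m) :
    TwoPowDvd (N + 1) (tau 0 (m + k * 2 ^ N) - tau 0 m
      - (k * 2 ^ N : ℕ) * ((s : ℚ) / (2 * m * (m + k * 2 ^ N) : ℕ))) := by
  obtain ⟨t, ht⟩ := exists_oddProd_mul_two_pow N hN (m - 1) k
  have hs : succSign (m + k * 2 ^ N) = succSign m := by
    obtain ⟨M, rfl⟩ := Nat.exists_eq_add_of_le' hN
    rw [succSign, succSign, show k * 2 ^ (M + 3) = 2 * (k * 2 ^ (M + 2)) by ring,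
      Nat.add_mul_mod_self_left]
  have hz : TwoPowDvd (N + (a + 1)) ((2 ^ N * (k * (succSign m * variationZero m - s)
      + 16 * m * (succSign m * oddFact (m - 1) * t)) : ℤ) : ℚ) := by
    apply TwoPowDvd.of_int
    rw [pow_add]
    exact mul_dvd_mul_left _ (dvd_add (h1.mul_left _) (h2.mul_right _))
  have hz2 := (TwoPowDvd.div_pow (M := N + 1) (k := a) (by
    rwa [show N + 1 + a = N + (a + 1) by ring])).div_odd (c := d) hdo (p := _)
  have hd' : (2 * m * (m + k * 2 ^ N) : ℚ) = 2 ^ a * d := by exact_mod_cast hd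
  rw [div_div, ← hd'] at hz2
  rw [tau_zero hm, tau_zero (by omega), hs,
    show m + k * 2 ^ N - 1 = m - 1 + k * 2 ^ N by omega, oddFact_add]
  have ht' : ((oddProd (m - 1) (k * 2 ^ N) : ℕ) : ℚ)
      = 1 + 2 ^ (N + 1) * (k * oddProdQuot (m - 1)) + 2 ^ (N + 4) * t := by exact_mod_cast ht
  convert hz2 using 1
  have hm0 : (m : ℚ) ≠ 0 := by exact_mod_cast (show m ≠ 0 by omega)
  have hn0 : (m + k * 2 ^ N : ℚ) ≠ 0 := by positivity
  push_cast [variationZero]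
  rw [ht', pow_add (2 : ℚ) N 1, pow_add (2 : ℚ) N 4]
  field_simp
  ring

/-! ### Assembling the congruence from its coefficients -/

/-- The monomial of weight `n` with exponents `v` away from `c₁`. -/
noncomputable def mono (n : ℕ) (v : ℕ+ →₀ ℕ) : RatPoly :=
  MvPolynomial.monomial (Finsupp.single 1 (n - wt v) + v) 1

theorem coeff_mono {n : ℕ} {u v : ℕ+ →₀ ℕ} (hv : v 1 = 0) (hu : wt u = n) :
    MvPolynomial.coeff u (mono n v) = if u.erase 1 = v then 1 else 0 := by
  rw [mono, MvPolynomial.coeff_monomial]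
  refine if_congr ⟨?_, ?_⟩ rfl rfl
  · rintro rfl
    ext j
    by_cases hj : j = 1
    · subst hj; simp [hv]
    · simp [Finsupp.erase_ne hj, Finsupp.single_eq_of_ne hj]
  · rintro rfl
    have h1 := congrArg wt (single_add_erase_one u)
    rw [map_add, wt_single, PNat.one_coe, mul_one, hu] at h1
    rw [show n - wt (u.erase 1) = u 1 by omega, single_add_erase_one]

theorem coeff_mono_of_ne {n : ℕ} {u v : ℕ+ →₀ ℕ} (hv : wt v ≤ n) (hu : wt u ≠ n) :
    MvPolynomial.coeff u (mono n v) = 0 := by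
  rw [mono, MvPolynomial.coeff_monomial, if_neg]
  rintro rfl
  apply hu
  rw [map_add, wt_single, PNat.one_coe, mul_one]
  omega

/-- At fixed weight the exponents away from `c₁` determine the monomial. The condition `hr` is
needed because for `wt (vec i) > n` truncated subtraction would give `mono` a weight other than `n`.
-/
theorem congrModTwoPow_of_tau {ι : Type*} [Fintype ι] {l m n M : ℕ} (hm : 2 ≤ m) (hn : n = m + l)
    (vec : ι → ℕ+ →₀ ℕ) (hinj : Function.Injective vec) (h1 : ∀ i, vec i 1 = 0)
    (r : ι → ℚ) (hr : ∀ i, r i = 0 ∨ wt (vec i) ≤ n)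
    (htau : ∀ i, TwoPowDvd M (tau (vec i) n - tau (vec i) m - r i))
    (hrest : ∀ v : ℕ+ →₀ ℕ, v 1 = 0 → (∀ i, v ≠ vec i) → TwoPowDvd M (tau v n - tau v m)) :
    CongrModTwoPow n M (dividedBernoulli n)
      (c 1 ^ l * dividedBernoulli m + ∑ i, r i • mono n (vec i)) := by
  classical
  apply congrModTwoPow_of_coeff
  · intro u
    rw [MvPolynomial.coeff_add, MvPolynomial.coeff_sum]
    simp only [MvPolynomial.coeff_smul, smul_eq_mul]
    by_cases hu : wt u = n
    · rw [coeff_dividedBernoulli_eq_tau (by omega) hu, coeff_pow_mul_dividedBernoulli hm hn hu,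
        Finset.sum_congr rfl fun i _ => by rw [coeff_mono (h1 i) hu]]
      by_cases hex : ∃ i, u.erase 1 = vec i
      · obtain ⟨i, hi⟩ := hex
        rw [Finset.sum_eq_single i]
        · rw [if_pos hi, mul_one, ← sub_sub, hi]
          exact htau i
        · intro j _ hj
          rw [if_neg, mul_zero]
          intro h
          exact hj (hinj (h.symm.trans hi))
        · intro h; exact absurd (Finset.mem_univ i) h
      · push Not at hex
        rw [Finset.sum_eq_zero fun i _ => by rw [if_neg (hex i), mul_zero], add_zero]
        exact hrest _ Finsupp.erase_same hex
    · rw [coeff_dividedBernoulli n (by omega), if_neg hu,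
        coeff_pow_mul_dividedBernoulli_eq_zero hm hn hu, Finset.sum_eq_zero]
      · simpa using TwoPowDvd.zero M
      · intro i _
        rcases hr i with h | h
        · rw [h, zero_mul]
        · rw [coeff_mono_of_ne h hu, mul_zero]
  · intro u hu
    rw [MvPolynomial.coeff_add, MvPolynomial.coeff_sum, coeff_dividedBernoulli n (by omega), if_neg hu,
      coeff_pow_mul_dividedBernoulli_eq_zero hm hn hu, Finset.sum_eq_zero]
    · simp
    · intro i _
      rw [MvPolynomial.coeff_smul]
      rcases hr i with h | h
      · rw [h, zero_smul]
      · rw [coeff_mono_of_ne h hu, smul_zero]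

/-- The exponents of `c₃`, `c₂`, `c₇` in the exceptional monomials. -/
def exponents : Fin 11 → ℕ × ℕ × ℕ :=
  ![(0, 0, 0), (1, 0, 0), (2, 0, 0), (3, 0, 0), (4, 0, 0), (5, 0, 0), (6, 0, 0), (8, 0, 0),
    (1, 1, 0), (2, 1, 0), (0, 0, 1)]

/-- The exceptional exponent vectors. -/
noncomputable def exceptional (i : Fin 11) : ℕ+ →₀ ℕ :=
  Finsupp.single 3 (exponents i).1 + Finsupp.single 2 (exponents i).2.1
    + Finsupp.single 7 (exponents i).2.2

theorem exceptional_injective : Function.Injective exceptional := by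
  intro i j h
  have h3 := DFunLike.congr_fun h 3
  have h2 := DFunLike.congr_fun h 2
  have h7 := DFunLike.congr_fun h 7
  simp [exceptional] at h3 h2 h7
  have hinj : Function.Injective exponents := by decide
  exact hinj (Prod.ext h3 (Prod.ext h2 h7))

theorem exceptional_one (i : Fin 11) : exceptional i 1 = 0 := by
  simp [exceptional]

theorem wt_exceptional (i : Fin 11) : wt (exceptional i)
    = (exponents i).1 * 3 + (exponents i).2.1 * 2 + (exponents i).2.2 * 7 := by
  rw [exceptional, map_add, map_add, wt_single, wt_single, wt_single]; rfl

theorem mono_exceptional (n : ℕ) (i : Fin 11) : mono n (exceptional i)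
    = c 1 ^ (n - wt (exceptional i)) * c 2 ^ (exponents i).2.1 * c 3 ^ (exponents i).1
      * c 7 ^ (exponents i).2.2 := by
  rw [mono]
  conv_lhs => rw [exceptional]
  simp only [c, MvPolynomial.X_pow_eq_monomial, MvPolynomial.monomial_mul, mul_one]
  rw [exceptional, add_comm (Finsupp.single 3 _) (Finsupp.single 2 _), add_assoc, add_assoc, add_assoc]

theorem eq_exceptional (v : ℕ+ →₀ ℕ) (i : Fin 11) {a b d : ℕ} (hi : exponents i = (a, b, d))
    (hv : v = Finsupp.single 3 a + Finsupp.single 2 b + Finsupp.single 7 d) : v = exceptional i := by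
  rw [exceptional, hi, hv]

theorem twoPowDvd_tau_sub_of_ne_exceptional {N k m : ℕ} (hN : 3 ≤ N) (hk : 0 < k)
    (hm : 2 * N + 1 ≤ m) {v : ℕ+ →₀ ℕ} (h1 : v 1 = 0) (hv : ∀ i, v ≠ exceptional i) :
    TwoPowDvd (N + 1) (tau v (m + k * 2 ^ N) - tau v m) := by
  refine twoPowDvd_tau_sub hN hk hm h1 ?_ ?_ ?_ ?_
  · intro e he
    have key : ∀ i : Fin 11, (exponents i).2 = (0, 0) → e ≠ (exponents i).1 := by
      intro i hi hei
      apply hv i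
      rw [exceptional, hi, he, hei]; simp
    have := key 0 rfl
    have := key 1 rfl
    have := key 2 rfl
    have := key 3 rfl
    have := key 4 rfl
    have := key 5 rfl
    have := key 6 rfl
    have := key 7 rfl
    simp only [exponents] at *
    simp at *
    omega
  · exact fun h => hv 8 (eq_exceptional v 8 rfl (by rw [h]; simp))
  · exact fun h => hv 9 (eq_exceptional v 9 rfl (by rw [h]; simp))
  · exact fun h => hv 10 (eq_exceptional v 10 rfl (by rw [h]; simp))

theorem congrModTwoPow_dividedBernoulli {N k l m n : ℕ} (hN : 3 ≤ N) (hk : Odd k)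
    (hl : l = k * 2 ^ N) (hm : 2 * N + 1 ≤ m) (hn : n = m + l) {r : ℚ}
    (hr : TwoPowDvd (N + 1) (tau 0 n - tau 0 m - r)) :
    CongrModTwoPow n (N + 1) (dividedBernoulli n) (c 1 ^ l * dividedBernoulli m
      + (r • c 1 ^ n
        + (l * ((numThree 1 m (N == 3) : ℚ) / 2)) • (c 1 ^ (n - 3) * c 3)
        + (l * ((numThree 2 m (N == 3) : ℚ) / 4)) • (c 1 ^ (n - 6) * c 3 ^ 2)
        + (l * ((numThree 3 m (N == 3) : ℚ) / 12)) • (c 1 ^ (n - 9) * c 3 ^ 3)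
        + (l * ((numThree 4 m (N == 3) : ℚ) / 48)) • (c 1 ^ (n - 12) * c 3 ^ 4)
        + (l * ((m % 2 : ℕ) : ℚ)) • (c 1 ^ (n - 15) * c 3 ^ 5)
        + (l * ((if m % 4 = 2 then 1 else 0 : ℕ) : ℚ)) • (c 1 ^ (n - 18) * c 3 ^ 6)
        + (l * ((if m % 8 = 0 ∧ m ≠ 8 then 1 else 0 : ℕ) : ℚ)) • (c 1 ^ (n - 24) * c 3 ^ 8)
        + (l : ℚ) • (c 1 ^ (n - 5) * c 2 * c 3)
        + (l : ℚ) • (c 1 ^ (n - 8) * c 2 * c 3 ^ 2)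
        + (l * ((m % 2 : ℕ) : ℚ)) • (c 1 ^ (n - 7) * c 7))) := by
  have hl8 : ∃ t, l = 8 * t ∧ 0 < t := by
    obtain ⟨M, rfl⟩ := Nat.exists_eq_add_of_le' hN
    have := hk.pos
    exact ⟨k * 2 ^ M, by rw [hl]; ring, by positivity⟩
  obtain ⟨t, ht, ht0⟩ := hl8
  have h := congrModTwoPow_of_tau (M := N + 1) (by omega) hn exceptional
    exceptional_injective exceptional_one
    ![r, l * ((numThree 1 m (N == 3) : ℚ) / 2), l * ((numThree 2 m (N == 3) : ℚ) / 4),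
      l * ((numThree 3 m (N == 3) : ℚ) / 12), l * ((numThree 4 m (N == 3) : ℚ) / 48),
      l * ((m % 2 : ℕ) : ℚ), l * ((if m % 4 = 2 then 1 else 0 : ℕ) : ℚ),
      l * ((if m % 8 = 0 ∧ m ≠ 8 then 1 else 0 : ℕ) : ℚ), l * ((1 : ℕ) : ℚ), l * ((1 : ℕ) : ℚ),
      l * ((m % 2 : ℕ) : ℚ)] ?_ ?_ ?_
  · convert h using 2
    simp only [Fin.sum_univ_succ, mono_exceptional, wt_exceptional, exponents]
    simp [add_assoc]
  · intro i
    rw [wt_exceptional]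
    -- Nonzero coefficients of `c₃^5, c₃^6, c₃^8` force `m ≥ 7, 10, 16`, and `l ≥ 8` then gives `n ≥
    -- 15, 18, 24`.
    fin_cases i <;> simp [exponents] <;> omega
  · subst hn hl
    intro i
    fin_cases i
    · have h := hr
      rw [eq_exceptional 0 0 rfl (by simp)] at h
      exact h
    · have h := tau_c_three_one hN hk hm
      rw [eq_exceptional (Finsupp.single 3 1) 1 rfl (by simp)] at h
      exact h
    · have h := tau_c_three_two hN hk hm
      rw [eq_exceptional (Finsupp.single 3 2) 2 rfl (by simp)] at h
      exact h
    · have h := tau_c_three_three hN hk hm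
      rw [eq_exceptional (Finsupp.single 3 3) 3 rfl (by simp)] at h
      exact h
    · have h := tau_c_three_four hN hk hm
      rw [eq_exceptional (Finsupp.single 3 4) 4 rfl (by simp)] at h
      exact h
    · have h := tau_c_three_five hN hk.pos hm
      rw [eq_exceptional (Finsupp.single 3 5) 5 rfl (by simp)] at h
      exact h
    · have h := tau_c_three_six hN hk.pos hm
      rw [eq_exceptional (Finsupp.single 3 6) 6 rfl (by simp)] at h
      exact h
    · have h := tau_c_three_eight hN hk hm
      rw [eq_exceptional (Finsupp.single 3 8) 7 rfl (by simp)] at h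
      exact h
    · have h := tau_c_two_c_three hN hk.pos hm
      rw [eq_exceptional (Finsupp.single 3 1 + Finsupp.single 2 1) 8 rfl (by simp)] at h
      exact h
    · have h := tau_c_two_c_three_sq hN hk.pos hm
      rw [eq_exceptional (Finsupp.single 3 2 + Finsupp.single 2 1) 9 rfl (by simp)] at h
      exact h
    · have h := tau_c_seven hN hk.pos hm
      rw [eq_exceptional (Finsupp.single 7 1) 10 rfl (by simp)] at h
      exact h
  · subst hn hl
    exact fun v h1 hv => twoPowDvd_tau_sub_of_ne_exceptional hN hk.pos hm h1 hv

/-! ### The coefficient of `c₁^n` by residue class of `m` -/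

theorem neg_doubleFactorial_div {n : ℕ} (hn : 2 ≤ n) (h2 : 2 ∣ n) :
    tau 0 n = -(((2 * n - 3)‼ : ℚ) / (2 * n)) := by
  obtain ⟨y, rfl⟩ := Nat.exists_eq_add_of_le' hn
  rw [tau_zero (by omega), succSign, if_neg (by omega),
    show 2 * (y + 2) - 3 = 2 * y + 1 by omega, doubleFactorial_eq_oddFact,
    show y + 2 - 1 = y + 1 by omega]
  push_cast
  ring

theorem sq_int_emod (m l : ℕ) (c : ℤ) (h : c ∣ (m : ℤ) * l) :
    (m : ℤ) * m ≡ m * (m + l) [ZMOD c] := by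
  rw [Int.modEq_iff_dvd]
  rw [show (m : ℤ) * (m + l) - m * m = m * l by ring]; exact h

theorem variationZero_mod (m : ℕ) (hm : 1 ≤ m) : ∃ y < 32, m % 32 = (y + 1) % 32 ∧
    variationZero m ≡ variationZero (y + 1) [ZMOD 64] := by
  obtain ⟨y, rfl⟩ := Nat.exists_eq_add_of_le' hm
  exact ⟨y % 32, Nat.mod_lt _ (by norm_num), by omega, variationZero_modEq y⟩

theorem sq_emod_of_emod {m z : ℕ} (h : m % 32 = z % 32) :
    2 * ((m : ℤ) * m) ≡ 2 * (z * z) [ZMOD 64] := by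
  have h1 : m * m ≡ z * z [MOD 32] := Nat.ModEq.mul h h
  have h2 : 2 * (m * m) ≡ 2 * (z * z) [MOD 2 * 32] := Nat.ModEq.mul_left' 2 h1
  exact_mod_cast Int.natCast_modEq_iff.2 h2

theorem tau_zero_odd {N k m : ℕ} (hN : 3 ≤ N) (hm : 1 ≤ m) (h : m % 2 = 1) :
    TwoPowDvd (N + 1) (tau 0 (m + k * 2 ^ N) - tau 0 m
      - -(oddSign m * ((k * 2 ^ N : ℕ) / 2 : ℚ))) := by
  obtain ⟨y, hy, hmy, hv⟩ := variationZero_mod m hm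
  have hl : k * 2 ^ N = 8 * (k * 2 ^ (N - 3)) := by
    obtain ⟨M, rfl⟩ := Nat.exists_eq_add_of_le' hN
    rw [Nat.add_sub_cancel]; ring
  have h1 := (variationZero_table y hy).1 (by omega)
  have h3 : oddSign m = oddSign (y + 1) := by
    rw [oddSign, oddSign, show (y + 1) % 4 = m % 4 by omega]
  have hsq : (m : ℤ) * m ≡ ((y + 1 : ℕ) : ℤ) * ((y + 1 : ℕ) : ℤ) [ZMOD 4] := by
    have h1 : m * m ≡ (y + 1) * (y + 1) [MOD 4] :=
      Nat.ModEq.mul (show m % 4 = (y + 1) % 4 by omega) (show m % 4 = (y + 1) % 4 by omega)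
    exact_mod_cast Int.natCast_modEq_iff.2 h1
  have hn := sq_int_emod m (k * 2 ^ N) 4
    ⟨m * (2 * (k * 2 ^ (N - 3) : ℕ)), by rw [hl]; push_cast; ring⟩
  have h4 := twoPowDvd_tau_zero (k := k) (m := m) (a := 1) (d := m * (m + k * 2 ^ N))
    (s := -(oddSign m * (m * (m + (k * 2 ^ N : ℕ))))) hN hm (by ring)
    (by
      refine (Nat.odd_iff.2 h).mul (Nat.odd_iff.2 ?_)
      omega) ?_ ?_
  · convert h4 using 2
    have hm0 : (m : ℚ) ≠ 0 := by exact_mod_cast (show m ≠ 0 by omega)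
    have hn0 : (m + k * 2 ^ N : ℚ) ≠ 0 := by positivity
    push_cast
    field_simp
  · rw [succSign, if_pos h, one_mul, sub_neg_eq_add]
    apply (Int.modEq_zero_iff_dvd).1
    refine Int.ModEq.trans ?_ h1
    rw [h3]
    exact (hv.of_dvd (by norm_num)).add (((hn.symm.trans hsq)).mul_left _)
  · exact Dvd.dvd.mul_right (by norm_num) _

theorem tau_zero_two_mod_four {N k m : ℕ} (hN : 3 ≤ N) (hm : 1 ≤ m) (h : m % 4 = 2) :
    TwoPowDvd (N + 1) (tau 0 (m + k * 2 ^ N) - tau 0 m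
      - ((k * 2 ^ N : ℕ) + (k * 2 ^ N : ℕ) / (2 * m * (m + k * 2 ^ N : ℕ)) : ℚ)) := by
  obtain ⟨y, hy, hmy, hv⟩ := variationZero_mod m hm
  have hl : k * 2 ^ N = 8 * (k * 2 ^ (N - 3)) := by
    obtain ⟨M, rfl⟩ := Nat.exists_eq_add_of_le' hN
    rw [Nat.add_sub_cancel]; ring
  have h1 := (variationZero_table y hy).2.1 (by omega)
  have hsq := sq_emod_of_emod hmy
  obtain ⟨z, hz⟩ : ∃ z, m = 4 * z + 2 := ⟨m / 4, by omega⟩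
  have hn := sq_int_emod m (k * 2 ^ N) 16
    ⟨(2 * z + 1) * (k * 2 ^ (N - 3) : ℕ), by rw [hl, hz]; push_cast; ring⟩
  have h4 := twoPowDvd_tau_zero (k := k) (m := m) (a := 3)
    (d := (2 * z + 1) * (2 * z + 1 + 4 * (k * 2 ^ (N - 3))))
    (s := 2 * (m * (m + (k * 2 ^ N : ℕ))) + 1) hN hm (by rw [hl, hz]; ring)
    (Odd.mul ⟨z, rfl⟩ ⟨z + 2 * (k * 2 ^ (N - 3)), by ring⟩) ?_ ?_
  · convert h4 using 2
    have hm0 : (m : ℚ) ≠ 0 := by exact_mod_cast (show m ≠ 0 by omega)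
    have hn0 : (m + k * 2 ^ N : ℚ) ≠ 0 := by positivity
    push_cast
    field_simp
  · rw [succSign, if_neg (by omega), show (-1 : ℤ) * variationZero m
      - (2 * (m * (m + (k * 2 ^ N : ℕ))) + 1)
      = -(variationZero m + 2 * (m * (m + (k * 2 ^ N : ℕ))) + 1) by ring]
    apply dvd_neg.2
    apply (Int.modEq_zero_iff_dvd).1
    refine Int.ModEq.trans ?_ h1
    have h5 := ((hn.symm.mul_left 2).of_dvd (show (2 ^ (3 + 1) : ℤ) ∣ 16 by norm_num)).trans
      (hsq.of_dvd (by norm_num))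
    push_cast at h5 ⊢
    exact ((hv.of_dvd (by norm_num)).add h5).add_right 1
  · exact Dvd.dvd.mul_right (by norm_num) _

theorem tau_zero_four_mod_eight {N k m : ℕ} (hN : 3 ≤ N) (hm : 1 ≤ m) (h : m % 8 = 4) :
    TwoPowDvd (N + 1) (tau 0 (m + k * 2 ^ N) - tau 0 m
      - ((k * 2 ^ N : ℕ) - (k * 2 ^ N : ℕ) / (2 * m * (m + k * 2 ^ N : ℕ)) : ℚ)) := by
  obtain ⟨y, hy, hmy, hv⟩ := variationZero_mod m hm
  have hl : k * 2 ^ N = 8 * (k * 2 ^ (N - 3)) := by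
    obtain ⟨M, rfl⟩ := Nat.exists_eq_add_of_le' hN
    rw [Nat.add_sub_cancel]; ring
  have h1 := (variationZero_table y hy).2.2 (by omega)
  have hsq := sq_emod_of_emod hmy
  obtain ⟨z, hz⟩ : ∃ z, m = 8 * z + 4 := ⟨m / 8, by omega⟩
  have hn := sq_int_emod m (k * 2 ^ N) 32
    ⟨(2 * z + 1) * (k * 2 ^ (N - 3) : ℕ), by rw [hl, hz]; push_cast; ring⟩
  have hn2 : 2 * ((m : ℤ) * m) ≡ 2 * (m * (m + (k * 2 ^ N : ℕ))) [ZMOD 64] := hn.mul_left'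
  have h4 := twoPowDvd_tau_zero (k := k) (m := m) (a := 5)
    (d := (2 * z + 1) * (2 * z + 1 + 2 * (k * 2 ^ (N - 3))))
    (s := 2 * (m * (m + (k * 2 ^ N : ℕ))) - 1) hN hm (by rw [hl, hz]; ring)
    (Odd.mul ⟨z, rfl⟩ ⟨z + (k * 2 ^ (N - 3)), by ring⟩) ?_ ?_
  · convert h4 using 2
    have hm0 : (m : ℚ) ≠ 0 := by exact_mod_cast (show m ≠ 0 by omega)
    have hn0 : (m + k * 2 ^ N : ℚ) ≠ 0 := by positivity
    push_cast
    field_simp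
  · rw [succSign, if_neg (by omega), show (-1 : ℤ) * variationZero m
      - (2 * (m * (m + (k * 2 ^ N : ℕ))) - 1)
      = -(variationZero m + 2 * (m * (m + (k * 2 ^ N : ℕ))) - 1) by ring]
    apply dvd_neg.2
    apply (Int.modEq_zero_iff_dvd).1
    refine Int.ModEq.trans ?_ h1
    have h5 := hn2.symm.trans hsq
    push_cast at h5 ⊢
    exact (hv.add h5).sub_right 1
  · rw [hz]
    exact ⟨2 * z + 1, by push_cast; ring⟩

end UniversalBernoulli

/-! ### The four cases of the theorem -/

open UniversalBernoulli
theorem theorem4p9 (N k l m n : ℕ) (hN : 3 ≤ N) (hk : Odd k) (hl : l = k * 2 ^ N)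
    (hm : 2 * N + 1 ≤ m) (hn : n = m + l) :
    (¬ 2 ∣ m →
      CongrModTwoPow n (N + 1) (dividedBernoulli n)
        (c 1 ^ l * dividedBernoulli m
          + (l : ℚ) • (c 1 ^ (n - 12) * c 3 ^ 4 + c 1 ^ (n - 15) * c 3 ^ 5
              + c 1 ^ (n - 5) * c 2 * c 3 + c 1 ^ (n - 8) * c 2 * c 3 ^ 2
              + c 1 ^ (n - 7) * c 7)
          + ((-1) ^ ((m + 1) / 2) * ((l : ℚ) / 2)) •
              (-c 1 ^ n + c 1 ^ (n - 3) * c 3 + c 1 ^ (n - 6) * c 3 ^ 2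
                + c 1 ^ (n - 9) * c 3 ^ 3))) ∧
    (2 ∣ m → ¬ 4 ∣ m →
      CongrModTwoPow n (N + 1) (dividedBernoulli n)
        (c 1 ^ l * dividedBernoulli m
          + ((l : ℚ) + (l : ℚ) / (2 * m * n)) • c 1 ^ n
          + (l : ℚ) • (c 1 ^ (n - 9) * c 3 ^ 3 + c 1 ^ (n - 18) * c 3 ^ 6
              + c 1 ^ (n - 5) * c 2 * c 3 + c 1 ^ (n - 8) * c 2 * c 3 ^ 2)
          - ((l : ℚ) / 2) • (c 1 ^ (n - 3) * c 3)
          + (3 / 4 * (l : ℚ)) • (c 1 ^ (n - 6) * c 3 ^ 2)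
          + (if N = 3 then -((l : ℚ) / 2) else (l : ℚ) / 2) • (c 1 ^ (n - 12) * c 3 ^ 4))) ∧
    (4 ∣ m → ¬ 8 ∣ m →
      CongrModTwoPow n (N + 1) (dividedBernoulli n)
        (c 1 ^ l * dividedBernoulli m
          + ((l : ℚ) - (l : ℚ) / (2 * m * n)) • c 1 ^ n
          + ((l : ℚ) / 2) • (c 1 ^ (n - 3) * c 3)
          + ((l : ℚ) / 4) • (c 1 ^ (n - 6) * c 3 ^ 2 + c 1 ^ (n - 12) * c 3 ^ 4)
          + (l : ℚ) • (c 1 ^ (n - 8) * c 2 * c 3 ^ 2 + c 1 ^ (n - 5) * c 2 * c 3))) ∧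
    (8 ∣ m →
      CongrModTwoPow n (N + 1) (dividedBernoulli n)
        (c 1 ^ l * dividedBernoulli m
          - (((2 * n - 3)‼ : ℚ) / (2 * n) - ((2 * m - 3)‼ : ℚ) / (2 * m)) • c 1 ^ n
          + ((l : ℚ) / 2) • (c 1 ^ (n - 3) * c 3)
          + (5 * (l : ℚ) / 4) • (c 1 ^ (n - 12) * c 3 ^ 4)
          + ((l : ℚ) / 4) • (c 1 ^ (n - 6) * c 3 ^ 2)
          + (l : ℚ) • ((if m = 8 then 0 else c 1 ^ (n - 24) * c 3 ^ 8)
              + c 1 ^ (n - 5) * c 2 * c 3 + c 1 ^ (n - 8) * c 2 * c 3 ^ 2))) := by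
  have hl8 : ∃ t, l = 8 * t ∧ 0 < t := by
    obtain ⟨M, rfl⟩ := Nat.exists_eq_add_of_le' hN
    have := hk.pos
    exact ⟨k * 2 ^ M, by rw [hl]; ring, by positivity⟩
  obtain ⟨t, ht, ht0⟩ := hl8
  refine ⟨fun h2 => ?_, fun h2 h4 => ?_, fun h4 h8 => ?_, fun h8 => ?_⟩
  · have e2 : m % 2 = 1 := by omega
    have hr := tau_zero_odd (k := k) hN (by omega) e2
    rw [← hl, ← hn] at hr
    convert congrModTwoPow_dividedBernoulli hN hk hl hm hn hr using 1
    simp only [neg_one_pow_half e2, numThree, e2, if_true, show m % 4 ≠ 2 by omega, if_false,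
      show ¬ (m % 8 = 0 ∧ m ≠ 8) by omega]
    push_cast
    module
  · have e4 : m % 4 = 2 := by omega
    have hr := tau_zero_two_mod_four (k := k) hN (by omega) e4
    rw [← hl, ← hn] at hr
    convert congrModTwoPow_dividedBernoulli hN hk hl hm hn hr using 1
    simp only [numThree, e4, show m % 2 = 0 by omega, zero_ne_one, ↓reduceIte,
      show ¬ (m % 8 = 0 ∧ m ≠ 8) by omega, beq_iff_eq]
    split_ifs <;> push_cast <;> module
  · have e8 : m % 8 = 4 := by omega
    have hr := tau_zero_four_mod_eight (k := k) hN (by omega) e8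
    rw [← hl, ← hn] at hr
    convert congrModTwoPow_dividedBernoulli hN hk hl hm hn hr using 1
    simp only [numThree, show m % 2 = 0 by omega, zero_ne_one, ↓reduceIte, false_and,
      show m % 4 ≠ 2 by omega, e8, OfNat.ofNat_ne_zero]
    push_cast
    module
  -- For `8 ∣ m` the 2-part of `2mn` is unbounded and no table applies; the exact difference is
  -- kept, so only divisibility of `0` is required.
  · have hr : TwoPowDvd (N + 1) (tau 0 n - tau 0 m
        - -((((2 * n - 3)‼ : ℕ) : ℚ) / (2 * n) - (((2 * m - 3)‼ : ℕ) : ℚ) / (2 * m))) := by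
      rw [neg_doubleFactorial_div (by omega) (by omega),
        neg_doubleFactorial_div (n := m) (by omega) (by omega)]
      ring_nf
      exact TwoPowDvd.zero _
    convert congrModTwoPow_dividedBernoulli hN hk hl hm hn hr using 1
    simp only [numThree, show m % 2 = 0 by omega, zero_ne_one, ↓reduceIte,
      show m % 4 ≠ 2 by omega, show m % 8 = 0 by omega, true_and, OfNat.zero_ne_ofNat]
    by_cases hm8 : m = 8
    · simp only [hm8, if_true, ne_eq, not_true_eq_false, if_false]
      push_cast
      module
    · simp only [hm8, if_false, ne_eq, not_false_eq_true, if_true]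
      push_cast
      module
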